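/- A \emph{2QCFA} consists of a finite set $Q$ of quantum basis states, a finite set $C$ of classical states, a finite input alphabet $\Sigma$, start states $q_{start}\in Q$ and $c_{start}\in C$, distinct halting states $c_{acc},c_{rej}\in C$, and a transition function that assigns to every non-halting classical state and every symbol of $\Sigma\sqcup\{\#_L,\#_R\}$ either a unitary $Q\times Q$ matrix to be applied to the quantum register together with a new classical state and a head movement in $\{-1,0,1\}$, or a projective measurement of the register given by a partition of $Q$ together with a new classical state and a head movement for each possible result. On input $w\in\Sigma^*$ the machine starts in classical state $c_{start}$, with quantum register $|q_{start}\rangle$ and its head on the leftmost cell of the tape $\#_L w\#_R$, which the head never leaves; it halts and accepts (rejects) when it enters $c_{acc}$ ($c_{rej}$). Its transition amplitudes are the entries of the unitary matrices that it uses. For a function $T$ on $\mathbb{N}$, $\epsilon>0$, $d\in\mathbb{N}$ and $\mathbb{A}\subseteq\mathbb{C}$, let $\mathsf{coR2QCFA}(T,\epsilon,d,\mathbb{A})$ be the class of all languages $L\subseteq\Sigma^*$ for which there is a 2QCFA $M$ with $d$ quantum basis states and transition amplitudes in $\mathbb{A}$ that runs in expected time $O(T(|w|))$ and satisfies, for all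 $w\in\Sigma^*$: $\Pr[M\text{ accepts }w]+\Pr[M\text{ rejects }w]=1$; if $w\in L$, then $\Pr[M\text{ accepts }w]=1$; if $w\notin L$, then $\Pr[M\text{ rejects }w]\ge 1-\epsilon$. For a group $G$ with a presentation $\langle S\mid R\rangle$, $S$ finite, the word problem $W_{G=\langle S\mid R\rangle}$ is the set of all words over $S\sqcup S^{-1}$ that represent the identity of $G$. \textbf{Theorem 2.} Let $G$ be a finitely generated group that has a finite-index subgroup isomorphic to a subgroup of a direct product of finitely many free groups of finite rank. Then for every presentation $G=\langle S\mid R\rangle$ with $S$ finite and every real $\epsilon>0$ there is a real $D\ge 1$ such that $$W_{G=\langle S\mid R\rangle}\in\mathsf{coR2QCFA}(D^n,\epsilon,2,\overline{\mathbb{Q}}),$$ where $\overline{\mathbb{Q}}\subseteq\mathbb{C}$ is the field of algebraic numbers. -/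

import Mathlib

open scoped ENNReal

noncomputable section

namespace TwoQCFA

/-! ### Quantum registers -/

/-- A superposition over the finite set `Q` of quantum basis states: amplitudes `ψ q` with
`∑ |ψ q|² = 1`. -/
@[ext]
structure Superposition (Q : Type*) [Fintype Q] where
  amp : Q → ℂ
  norm_one : ∑ q, ‖amp q‖ ^ 2 = 1

/-- The probability `∑_{q ∈ b} |ψ q|²` that a projective measurement in the computational basis
gives the block `b`. -/
def Superposition.weight {Q : Type*} [Fintype Q] (ψ : Superposition Q) (b : Finset Q) : ℝ :=
  ∑ q ∈ b, ‖ψ.amp q‖ ^ 2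

theorem Superposition.weight_nonneg {Q : Type*} [Fintype Q] (ψ : Superposition Q)
    (b : Finset Q) : 0 ≤ ψ.weight b :=
  Finset.sum_nonneg fun _ _ => by positivity

variable {Q : Type*} [Fintype Q] [DecidableEq Q]

/-- The basis state `|q⟩`. -/
def Superposition.basis (q : Q) : Superposition Q :=
  ⟨Pi.single q 1, by
    rw [Finset.sum_eq_single q]
    · simp
    · intro b _ hb
      simp [Pi.single_eq_of_ne hb]
    · simp⟩

theorem sum_norm_sq_mulVec (t : Matrix.unitaryGroup Q ℂ) (ψ : Q → ℂ) :
    ∑ q, ‖((t : Matrix Q Q ℂ).mulVec ψ) q‖ ^ 2 = ∑ q, ‖ψ q‖ ^ 2 := by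
  have key : ∀ v : Q → ℂ, ((∑ q, ‖v q‖ ^ 2 : ℝ) : ℂ) = star v ⬝ᵥ v := by
    intro v
    simp only [dotProduct, Pi.star_apply, RCLike.star_def, Complex.ofReal_sum,
      Complex.conj_mul', Complex.ofReal_pow]
  have h : star ((t : Matrix Q Q ℂ).mulVec ψ) ⬝ᵥ ((t : Matrix Q Q ℂ).mulVec ψ)
      = star ψ ⬝ᵥ ψ := by
    rw [Matrix.star_mulVec, Matrix.dotProduct_mulVec, Matrix.vecMul_vecMul,
      ← Matrix.star_eq_conjTranspose, Matrix.UnitaryGroup.star_mul_self, Matrix.vecMul_one]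
  exact Complex.ofReal_injective (by rw [key, key, h])

/-- Applying the unitary `t` to the superposition `ψ`. -/
def Superposition.apply (t : Matrix.unitaryGroup Q ℂ) (ψ : Superposition Q) :
    Superposition Q :=
  ⟨(t : Matrix Q Q ℂ).mulVec ψ.amp, (sum_norm_sq_mulVec t ψ.amp).trans ψ.norm_one⟩

/-- The superposition to which `ψ` collapses when the result of a measurement is the block `b`:
amplitudes outside `b` are set to `0`, and the vector is rescaled to norm one. (If `b` has
probability zero this never happens, and the value is irrelevant.) -/
def Superposition.collapse (ψ : Superposition Q) (b : Finset Q) : Superposition Q :=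
  if h : ψ.weight b = 0 then ψ else
    ⟨fun q => if q ∈ b then ((1 / Real.sqrt (ψ.weight b) : ℝ) : ℂ) * ψ.amp q else 0, by
      have h1 : ∀ q, ‖(if q ∈ b then ((1 / Real.sqrt (ψ.weight b) : ℝ) : ℂ) * ψ.amp q
          else (0 : ℂ))‖ ^ 2 = if q ∈ b then (ψ.weight b)⁻¹ * ‖ψ.amp q‖ ^ 2 else 0 := by
        intro q
        split_ifs
        · rw [norm_mul, mul_pow, Complex.norm_real, Real.norm_eq_abs, sq_abs, div_pow,
            Real.sq_sqrt (ψ.weight_nonneg b)]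
          simp
        · simp
      rw [Finset.sum_congr rfl fun q _ => h1 q, Finset.sum_ite_mem, Finset.univ_inter,
        ← Finset.mul_sum]
      exact inv_mul_cancel₀ h⟩

theorem Superposition.sum_weight (ψ : Superposition Q)
    (B : Finpartition (Finset.univ : Finset Q)) :
    ∑ b : {b // b ∈ B.parts}, ENNReal.ofReal (ψ.weight b.1) = 1 := by
  rw [← ENNReal.ofReal_sum_of_nonneg fun b _ => ψ.weight_nonneg b.1,
    Finset.sum_coe_sort B.parts fun b => ψ.weight b]
  have : ∑ b ∈ B.parts, ψ.weight b = ∑ q, ‖ψ.amp q‖ ^ 2 := by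
    have h := Finset.sum_biUnion (f := fun q => ‖ψ.amp q‖ ^ 2) B.disjoint
    rw [B.biUnion_parts] at h
    exact h.symm
  rw [this, ψ.norm_one, ENNReal.ofReal_one]

/-- The distribution of the result of measuring `ψ` with respect to the partition `B`. -/
def Superposition.measure (ψ : Superposition Q) (B : Finpartition (Finset.univ : Finset Q)) :
    PMF {b // b ∈ B.parts} :=
  PMF.ofFintype (fun b => ENNReal.ofReal (ψ.weight b.1)) (ψ.sum_weight B)

/-! ### Machines -/

/-- The tape alphabet: the input alphabet together with two distinct end-markers. -/
inductive TapeSymbol (α : Type*) where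
  | leftEnd : TapeSymbol α
  | letter (a : α) : TapeSymbol α
  | rightEnd : TapeSymbol α

/-- Head movements `-1`, `0`, `1`. -/
inductive HeadMove where
  | left
  | stay
  | right

/-- What a machine does in one step: either apply a unitary transformation to the quantum register
(and update the classical state and the head), or perform a projective measurement given by a
partition of the basis states and update the classical state and the head according to the
result. -/
inductive Action (Q : Type*) [Fintype Q] [DecidableEq Q] (C : Type*) where
  | unitary (t : Matrix.unitaryGroup Q ℂ) (c : C) (h : HeadMove)
  | measurement (B : Finpartition (Finset.univ : Finset Q))
      (f : {b // b ∈ B.parts} → C × HeadMove)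

/-- The head movements that an action may result in. -/
def Action.moves {C : Type*} : Action Q C → Set HeadMove
  | .unitary _ _ h => {h}
  | .measurement _ f => Set.range fun b => (f b).2

/-- A two-way finite automaton with quantum and classical states (2QCFA), with set of quantum
basis states `Q`, set of classical states `C` and input alphabet `α`.
The values of `δ` at the two halting states are never used. The last two fields say that the head
never leaves the tape. -/
structure Machine (Q : Type*) [Fintype Q] [DecidableEq Q] (C : Type*) (α : Type*) where
  δ : C → TapeSymbol α → Action Q C
  qStart : Q
  cStart : C
  cAcc : C
  cRej : C
  acc_ne_rej : cAcc ≠ cRej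
  not_left : ∀ c, c ≠ cAcc → c ≠ cRej → HeadMove.left ∉ (δ c .leftEnd).moves
  not_right : ∀ c, c ≠ cAcc → c ≠ cRej → HeadMove.right ∉ (δ c .rightEnd).moves

/-- The content of cell `i` of the tape `#_L w #_R`, which has `|w| + 2` cells. -/
def tape {α : Type*} (w : List α) (i : Fin (w.length + 2)) : TapeSymbol α :=
  if i.1 = 0 then .leftEnd
  else if h : i.1 - 1 < w.length then .letter (w[i.1 - 1]) else .rightEnd

/-- Moving the head. (The truncations at the two ends are never used by a machine.) -/
def moveHead {n : ℕ} (i : Fin (n + 2)) : HeadMove → Fin (n + 2)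
  | .left => ⟨i.1 - 1, by omega⟩
  | .stay => i
  | .right => ⟨min (i.1 + 1) (n + 1), by omega⟩

/-- A configuration on an input of length `n`: the classical state, the head position, and the
superposition of the quantum register. -/
structure Config (Q : Type*) [Fintype Q] (C : Type*) (n : ℕ) where
  state : C
  head : Fin (n + 2)
  register : Superposition Q

namespace Machine

variable {C α : Type*} (M : Machine Q C α)

/-- The distribution of the configuration that follows `x`, where `x` is not halting, when the
action `a` is performed. -/
def act {n : ℕ} (a : Action Q C) (x : Config Q C n) : PMF (Config Q C n) :=
  match a with
  | .unitary t c h => PMF.pure ⟨c, moveHead x.head h, x.register.apply t⟩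
  | .measurement B f => (x.register.measure B).map fun b =>
      ⟨(f b).1, moveHead x.head (f b).2, x.register.collapse b.1⟩

open Classical in
/-- One step of the computation of `M` on the input `w`. A halting configuration is kept
for ever. -/
def step (w : List α) (x : Config Q C w.length) : PMF (Config Q C w.length) :=
  if x.state = M.cAcc ∨ x.state = M.cRej then PMF.pure x
  else act (M.δ x.state (tape w x.head)) x

/-- The initial configuration on the input `w`. -/
def init (w : List α) : Config Q C w.length :=
  ⟨M.cStart, 0, Superposition.basis M.qStart⟩

/-- The distribution of the configuration of `M` on the input `w` after `t` steps. -/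
def run (w : List α) : ℕ → PMF (Config Q C w.length)
  | 0 => PMF.pure (M.init w)
  | t + 1 => (run w t).bind (M.step w)

/-- `Pr[M accepts w]`: the probability of having accepted within `t` steps is non-decreasing in
`t`, and this is its limit. -/
def acceptProb (w : List α) : ℝ≥0∞ :=
  ⨆ t, (M.run w t).toOuterMeasure {x | x.state = M.cAcc}

/-- `Pr[M rejects w]`. -/
def rejectProb (w : List α) : ℝ≥0∞ :=
  ⨆ t, (M.run w t).toOuterMeasure {x | x.state = M.cRej}

/-- The expected running time of `M` on `w`, i.e. the expectation `∑_{t ≥ 0} Pr[τ > t]` of the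
number `τ ∈ {0, 1, 2, …, ∞}` of steps that `M` makes before it halts. -/
def expectedTime (w : List α) : ℝ≥0∞ :=
  ∑' t, (M.run w t).toOuterMeasure {x | x.state ≠ M.cAcc ∧ x.state ≠ M.cRej}

/-- The entries of all unitary transformations that `M` may perform lie in `𝔸`. -/
def HasAmplitudesIn (𝔸 : Set ℂ) : Prop :=
  ∀ (c : C) (γ : TapeSymbol α) (t : Matrix.unitaryGroup Q ℂ) (c' : C) (h : HeadMove),
    c ≠ M.cAcc → c ≠ M.cRej → M.δ c γ = .unitary t c' h →
      ∀ i j, (t : Matrix Q Q ℂ) i j ∈ 𝔸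

end Machine

/-- The class `coR2QCFA(T, ε, d, 𝔸)` over the finite alphabet `α`: languages `L` that some 2QCFA
with `d` quantum basis states and transition amplitudes in `𝔸` recognizes in expected time
`O(T(|w|))`, halting with probability one, accepting every word of `L` with probability one and
rejecting every other word with probability at least `1 - ε`. -/
def coR2QCFA {α : Type*} [Finite α] (T : ℕ → ℝ) (ε : ℝ) (d : ℕ) (𝔸 : Set ℂ) :
    Set (Language α) :=
  {L | ∃ (C : Type) (_ : Finite C) (M : Machine (Fin d) C α),
    M.HasAmplitudesIn 𝔸 ∧
    (∀ w, M.expectedTime w ≠ ∞) ∧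
    (∃ (K : ℝ) (N : ℕ), ∀ w : List α, N ≤ w.length →
      M.expectedTime w ≤ ENNReal.ofReal (K * T w.length)) ∧
    ∀ w : List α, M.acceptProb w + M.rejectProb w = 1 ∧
      (w ∈ L → M.acceptProb w = 1) ∧
      (w ∉ L → ENNReal.ofReal (1 - ε) ≤ M.rejectProb w)}

end TwoQCFA

/-! ### Groups -/

/-- The element of `⟨S | R⟩` represented by a letter of the alphabet `S ⊔ S⁻¹`; `Sum.inr s` is the
formal inverse of `s`. -/
def letterValue {S : Type*} (R : Set (FreeGroup S)) : S ⊕ S → PresentedGroup R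
  | Sum.inl s => PresentedGroup.of s
  | Sum.inr s => (PresentedGroup.of s)⁻¹

/-- The word problem of `⟨S | R⟩`: the words over `S ⊔ S⁻¹` that represent the identity. -/
def wordProblem {S : Type*} (R : Set (FreeGroup S)) : Language (S ⊕ S) :=
  {w | (w.map (letterValue R)).prod = 1}

/-- `G` is virtually a subgroup of a direct product of finitely many free groups of finite
rank. -/
def IsVirtuallySubgroupProdFree (G : Type*) [Group G] : Prop :=
  ∃ H : Subgroup G, H.FiniteIndex ∧
    ∃ (m : ℕ) (k : Fin m → ℕ) (f : H →* ((i : Fin m) → FreeGroup (Fin (k i)))),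
      Function.Injective f

end

/-!
The machine runs finitely many tests on one qubit. Each test multiplies unitary matrices along the
input and looks at a single entry of the product, and the matrices are chosen so that a nonzero
entry cannot be too small.

*The matrices.* `freeRep` sends the generators `a` and `b` of the free group of rank two to a
diagonal matrix and to a rotation, both with entries in `ℤ[i] / 5`. Modulo the prime `2 + i` five
times a generator or its inverse has rank one, and a product along a nonempty reduced word does not
vanish (`exists_mapMatrix_gaussMod_prod`), whereas `5 ^ n` does; so `freeRep` is faithful. The
conjugates `a ^ j * b * a ^ (-j)` generate a free group of any given finite rank in which only `1`
commutes with `a` (`eq_one_of_commute_conjEmbedding`). A unitary matrix whose lower left entry is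
zero is diagonal and commutes with the image of `a`; hence every other element of this subgroup is
mapped to a matrix with a nonzero lower left entry (`freeRep_conjEmbedding_ne_zero`). For a product
of `n` gates with denominator `5 ^ e` the squared norm of such an entry is at least `25 ^ (-e n)`
(`GaussDenominator.le_norm_sq`).

*The tests.* Let `H` be the finite-index subgroup. While reading a word the machine follows the
coset of the product read so far and applies the images of Schreier elements, so that at the end it
has applied the image of a conjugate of the inverse of the word (`gateAfter_cosetSystem`), provided
that the word lies in `H`. Starting from `|0⟩` it measures `1` with probability the squared norm of
the lower left entry. There is one such test for every free factor; a nontrivial word fails one of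
them with probability at least `25 ^ (-e n)`, and a trivial word passes all of them
(`forall_passProb_cosetSystem`).

*The rounds.* After a round of tests the machine accepts with probability `p ^ (n + 2)`, by tossing
a coin in every cell of the tape, and otherwise begins a new round. If `p ≤ 25 ^ (-e)` and `p ≤ ε`,
then for a nontrivial word rejection in a round is at least `1 / ε` times as likely as acceptance,
and the expected number of rounds is at most `p ^ (-n - 2)`. Both bounds are proved by potential
functions on the configurations (`Machine.expectedTime_le`, `Machine.acceptProb_le`,
`potential_time`, `potential_accept`), which have to be compared only along single steps.
-/

/-! ### A free group of unitary matrices over `ℚ(i)` -/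

namespace TwoQCFA

/-- The real rotation with cosine `c` and sine `s`, as a unitary matrix. -/
noncomputable def rotation (c s : ℝ) (h : c ^ 2 + s ^ 2 = 1) : Matrix.unitaryGroup (Fin 2) ℂ :=
  ⟨!![(c : ℂ), -(s : ℂ); (s : ℂ), (c : ℂ)], by
    have h' : (c : ℂ) * c + s * s = 1 := by
      rw [← sq, ← sq]; exact_mod_cast h
    rw [Matrix.mem_unitaryGroup_iff]
    ext i j
    fin_cases i <;> fin_cases j <;>
      simp [Matrix.mul_apply, Matrix.star_apply, h'] <;>
      first | ring1 | linear_combination h'⟩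

/-- The diagonal unitary matrix with entries `(3 ± 4i) / 5`. -/
noncomputable def diagUnitary : Matrix.unitaryGroup (Fin 2) ℂ :=
  ⟨!![(3 + 4 * Complex.I) / 5, 0; 0, (3 - 4 * Complex.I) / 5], by
    rw [Matrix.mem_unitaryGroup_iff]
    ext i j
    fin_cases i <;> fin_cases j <;>
      simp [Matrix.mul_apply, Matrix.star_apply, map_ofNat] <;>
      (ring_nf; try (rw [Complex.I_sq]; norm_num))⟩

/-- The representation of the free group of rank two that sends the generators `false` and `true`
to `diagUnitary` and to a rotation with cosine `3/5`. -/
noncomputable def freeRep : FreeGroup Bool →* Matrix.unitaryGroup (Fin 2) ℂ :=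
  FreeGroup.lift fun b =>
    if b then rotation (3 / 5) (-4 / 5) (by norm_num) else diagUnitary

/-- Five times the image of a letter under `freeRep`, a matrix over the Gaussian integers. -/
def gaussLetter : Bool × Bool → Matrix (Fin 2) (Fin 2) GaussianInt
  | (false, true) => !![⟨3, 4⟩, 0; 0, ⟨3, -4⟩]
  | (false, false) => !![⟨3, -4⟩, 0; 0, ⟨3, 4⟩]
  | (true, true) => !![3, 4; -4, 3]
  | (true, false) => !![3, -4; 4, 3]

theorem mapMatrix_gaussLetter (l : Bool × Bool) :
    GaussianInt.toComplex.mapMatrix (gaussLetter l) =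
      (5 : ℂ) • (freeRep (FreeGroup.mk [l]) : Matrix (Fin 2) (Fin 2) ℂ) := by
  obtain ⟨x, s⟩ := l
  cases x <;> cases s <;> ext i j <;> fin_cases i <;> fin_cases j <;>
    simp [gaussLetter, freeRep, diagUnitary, rotation, GaussianInt.toComplex_def',
      Matrix.star_apply, map_ofNat] <;> ring

theorem mapMatrix_prod_gaussLetter (L : List (Bool × Bool)) :
    GaussianInt.toComplex.mapMatrix (L.map gaussLetter).prod =
      (5 ^ L.length : ℂ) • (freeRep (FreeGroup.mk L) : Matrix (Fin 2) (Fin 2) ℂ) := by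
  induction L with
  | nil =>
    have : FreeGroup.mk ([] : List (Bool × Bool)) = 1 := rfl
    simp [this]
  | cons l L ih =>
    have : FreeGroup.mk (l :: L) = FreeGroup.mk [l] * FreeGroup.mk L := by
      simp
    rw [this, List.map_cons, List.prod_cons, map_mul, ih, mapMatrix_gaussLetter, map_mul,
      Matrix.UnitaryGroup.mul_val, smul_mul_smul_comm, List.length_cons, pow_succ']

/-- Reduction modulo the prime `2 + i` of the Gaussian integers, which sends `i` to `3`. -/
def gaussMod : GaussianInt →+* ZMod 5 := Zsqrtd.lift ⟨3, by decide⟩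

/-- Modulo `2 + i` the matrix of a letter is the rank-one matrix `u vᵀ`; this is `u`. -/
def colVec : Bool × Bool → Fin 2 → ZMod 5
  | (false, true) => ![0, 1]
  | (false, false) => ![1, 0]
  | (true, true) => ![3, 1]
  | (true, false) => ![1, 3]

/-- Modulo `2 + i` the matrix of a letter is the rank-one matrix `u vᵀ`; this is `v`. -/
def rowVec : Bool × Bool → Fin 2 → ZMod 5
  | (false, true) => ![0, 1]
  | (false, false) => ![1, 0]
  | (true, true) => ![1, 3]
  | (true, false) => ![3, 1]

theorem mapMatrix_gaussMod (l : Bool × Bool) :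
    gaussMod.mapMatrix (gaussLetter l) = Matrix.vecMulVec (colVec l) (rowVec l) := by
  obtain ⟨x, s⟩ := l
  cases x <;> cases s <;> ext i j <;> fin_cases i <;> fin_cases j <;> decide

theorem colVec_ne_zero : ∀ l, colVec l ≠ 0 := by decide

theorem rowVec_ne_zero : ∀ l, rowVec l ≠ 0 := by decide

theorem rowVec_dotProduct_colVec :
    ∀ l l' : Bool × Bool, (l.1 = l'.1 → l.2 = l'.2) → rowVec l ⬝ᵥ colVec l' ≠ 0 := by
  decide

/-- Modulo `2 + i`, a product along a nonempty reduced word is a product of rank-one matrices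
`u vᵀ` in which no inner factor `vᵀ u` vanishes. -/
theorem exists_mapMatrix_gaussMod_prod [Fact (Nat.Prime 5)] {l : Bool × Bool}
    {L : List (Bool × Bool)}
    (h : FreeGroup.IsReduced (l :: L)) :
    ∃ y ≠ 0, gaussMod.mapMatrix ((l :: L).map gaussLetter).prod =
      Matrix.vecMulVec (colVec l) y := by
  induction L generalizing l with
  | nil =>
    exact ⟨rowVec l, rowVec_ne_zero l, by simpa using mapMatrix_gaussMod l⟩
  | cons l' L ih =>
    unfold FreeGroup.IsReduced at h
    rw [List.isChain_cons_cons] at h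
    obtain ⟨y, hy, e⟩ := ih h.2
    refine ⟨(rowVec l ⬝ᵥ colVec l') • y, smul_ne_zero (rowVec_dotProduct_colVec l l' h.1) hy, ?_⟩
    rw [List.map_cons, List.prod_cons, map_mul, e, mapMatrix_gaussMod,
      Matrix.vecMulVec_mul_vecMulVec]

theorem mapMatrix_gaussMod_prod_ne_zero {L : List (Bool × Bool)} (h : FreeGroup.IsReduced L)
    (hL : L ≠ []) : gaussMod.mapMatrix (L.map gaussLetter).prod ≠ 0 := by
  have : Fact (Nat.Prime 5) := ⟨by norm_num⟩
  obtain ⟨l, L, rfl⟩ := List.exists_cons_of_ne_nil hL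
  obtain ⟨y, hy, e⟩ := exists_mapMatrix_gaussMod_prod h
  rw [e]
  intro h0
  rcases Matrix.vecMulVec_eq_zero.1 h0 with h1 | h1
  · exact colVec_ne_zero l h1
  · exact hy h1

theorem freeRep_injective : Function.Injective freeRep := by
  rw [injective_iff_map_eq_one]
  intro g hg
  by_contra hne
  have hL : g.toWord ≠ [] := fun h => hne (FreeGroup.toWord_eq_nil_iff.1 h)
  have hred : FreeGroup.IsReduced g.toWord := FreeGroup.isReduced_toWord
  apply mapMatrix_gaussMod_prod_ne_zero hred hL
  have h := mapMatrix_prod_gaussLetter g.toWord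
  rw [FreeGroup.mk_toWord, hg] at h
  -- If `g` acts trivially, the Gaussian matrix of its word is `5 ^ n`, which vanishes mod `2 + i`.
  have h2 : (g.toWord.map gaussLetter).prod =
      ((5 : GaussianInt) ^ g.toWord.length) • (1 : Matrix (Fin 2) (Fin 2) GaussianInt) := by
    ext1 i j
    apply GaussianInt.toComplex_inj.1
    have := congrFun (congrFun h i) j
    simp only [RingHom.mapMatrix_apply, Matrix.map_apply] at this
    rw [this]
    by_cases hij : i = j <;> simp [hij, map_ofNat]
  rw [h2]
  have h5 : gaussMod 5 = 0 := by decide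
  have hn : g.toWord.length ≠ 0 := by simpa using hL
  ext i j
  simp [h5, hn]

/-- A unitary matrix that has zero below the diagonal commutes with `diagUnitary`. -/
theorem commute_diagUnitary (t : Matrix.unitaryGroup (Fin 2) ℂ)
    (h : (t : Matrix (Fin 2) (Fin 2) ℂ) 1 0 = 0) : Commute t diagUnitary := by
  have h0 := t.2
  have h1 := Matrix.mem_unitaryGroup_iff'.1 h0
  have h2 := Matrix.mem_unitaryGroup_iff.1 h0
  have e1 := congrFun (congrFun h1 0) 0
  have e2 := congrFun (congrFun h1 0) 1
  simp [Matrix.mul_apply, Matrix.star_apply, h] at e1 e2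
  -- The first column has norm one and is orthogonal to the second.
  have h01 : (t : Matrix (Fin 2) (Fin 2) ℂ) 0 1 = 0 := by
    rcases e2 with e | e
    · simp [e] at e1
    · exact e
  apply Subtype.ext
  ext i j
  fin_cases i <;> fin_cases j <;>
    simp [Matrix.mul_apply, diagUnitary, h, h01, mul_comm]

/-! ### Free groups of finite rank inside the free group of rank two -/

/-- The map that sends the `j`-th generator to `a ^ j * b * a ^ (-j)`, where `a` and `b` are the
generators `false` and `true`. -/
def conjEmbedding (k : ℕ) : FreeGroup (Fin k) →* FreeGroup Bool :=
  FreeGroup.lift fun j =>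
    FreeGroup.of false ^ (j : ℕ) * FreeGroup.of true * (FreeGroup.of false ^ (j : ℕ))⁻¹

/-- The automorphism of the free group on `ℤ` that shifts the generators by one. -/
def shiftAut : MulAut (FreeGroup ℤ) := FreeGroup.freeGroupCongr (Equiv.addRight 1)

theorem shiftAut_pow_of (n : ℕ) (z : ℤ) :
    (shiftAut ^ n) (FreeGroup.of z) = FreeGroup.of (z + n) := by
  induction n generalizing z with
  | zero => simp
  | succ n ih =>
    rw [pow_succ, MulAut.mul_apply]
    have : shiftAut (FreeGroup.of z) = FreeGroup.of (z + 1) := by simp [shiftAut]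
    rw [this, ih]
    congr 1; push_cast; ring

/-- The semidirect product of the free group on `ℤ` with the shift. -/
abbrev ShiftProduct : Type :=
  SemidirectProduct (FreeGroup ℤ) (Multiplicative ℤ) (zpowersHom (MulAut (FreeGroup ℤ)) shiftAut)

/-- The homomorphism from the free group of rank two that sends `a` to the shift and `b` to the
generator `0`. -/
def toShiftProduct : FreeGroup Bool →* ShiftProduct :=
  FreeGroup.lift fun b =>
    if b then SemidirectProduct.inl (FreeGroup.of 0)
    else SemidirectProduct.inr (Multiplicative.ofAdd 1)

theorem toShiftProduct_conjEmbedding {k : ℕ} (w : FreeGroup (Fin k)) :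
    toShiftProduct (conjEmbedding k w) =
      SemidirectProduct.inl (FreeGroup.map (fun j : Fin k => ((j : ℕ) : ℤ)) w) := by
  have : toShiftProduct.comp (conjEmbedding k) =
      SemidirectProduct.inl.comp (FreeGroup.map (fun j : Fin k => ((j : ℕ) : ℤ))) := by
    ext1 j
    simp only [MonoidHom.comp_apply, conjEmbedding, toShiftProduct, FreeGroup.lift_apply_of,
      map_mul, map_pow, map_inv, FreeGroup.map.of, if_true, Bool.false_eq_true, if_false]
    rw [← map_pow, ← map_inv, ← SemidirectProduct.inl_aut, zpowersHom_apply]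
    congr 1
    have : Multiplicative.toAdd (Multiplicative.ofAdd (1 : ℤ) ^ (j : ℕ)) = ((j : ℕ) : ℤ) := by simp
    rw [this, zpow_natCast, shiftAut_pow_of]
    simp
  exact DFunLike.congr_fun this w

/-- The shift by `k` moves the generators `0, …, k - 1` off themselves, so that it fixes no
nontrivial word in them. -/
theorem eq_one_of_shiftAut_map {k : ℕ} (w : FreeGroup (Fin k))
    (h : shiftAut (FreeGroup.map (fun j : Fin k => ((j : ℕ) : ℤ)) w) =
      FreeGroup.map (fun j : Fin k => ((j : ℕ) : ℤ)) w) : w = 1 := by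
  have hp : ∀ n : ℕ, (shiftAut ^ n) (FreeGroup.map (fun j : Fin k => ((j : ℕ) : ℤ)) w) =
      FreeGroup.map (fun j : Fin k => ((j : ℕ) : ℤ)) w := by
    intro n
    induction n with
    | zero => simp
    | succ n ih => rw [pow_succ, MulAut.mul_apply, h, ih]
  -- The homomorphism that kills every generator outside `0, …, k - 1`.
  let κ : FreeGroup ℤ →* FreeGroup (Fin k) := FreeGroup.lift fun z =>
    if hz : z.toNat < k ∧ 0 ≤ z then FreeGroup.of ⟨z.toNat, hz.1⟩ else 1
  have h1 : κ.comp (FreeGroup.map (fun j : Fin k => ((j : ℕ) : ℤ))) = MonoidHom.id _ := by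
    ext1 j
    simp [κ]
  have h2 : (κ.comp (shiftAut ^ k : MulAut (FreeGroup ℤ)).toMonoidHom).comp
      (FreeGroup.map (fun j : Fin k => ((j : ℕ) : ℤ))) = 1 := by
    ext1 j
    simp only [MonoidHom.comp_apply, FreeGroup.map.of, MulEquiv.coe_toMonoidHom, shiftAut_pow_of,
      κ, FreeGroup.lift_apply_of, MonoidHom.one_apply]
    rw [dif_neg]
    omega
  have e1 := DFunLike.congr_fun h1 w
  have e2 := DFunLike.congr_fun h2 w
  simp only [MonoidHom.comp_apply, MulEquiv.coe_toMonoidHom, hp k, MonoidHom.one_apply,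
    MonoidHom.id_apply] at e1 e2
  exact e1.symm.trans e2

theorem eq_one_of_commute_conjEmbedding {k : ℕ} (w : FreeGroup (Fin k))
    (h : Commute (conjEmbedding k w) (FreeGroup.of false)) : w = 1 := by
  apply eq_one_of_shiftAut_map
  have h1 : Commute (toShiftProduct (FreeGroup.of false)) (toShiftProduct (conjEmbedding k w)) :=
    (h.map toShiftProduct).symm
  have h2 : toShiftProduct (FreeGroup.of false) =
      SemidirectProduct.inr (Multiplicative.ofAdd 1) := by simp [toShiftProduct]
  rw [toShiftProduct_conjEmbedding, h2] at h1
  have h3 := SemidirectProduct.inl_aut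
    (φ := zpowersHom (MulAut (FreeGroup ℤ)) shiftAut) (Multiplicative.ofAdd 1)
    (FreeGroup.map (fun j : Fin k => ((j : ℕ) : ℤ)) w)
  rw [h1.eq, map_inv, mul_inv_cancel_right] at h3
  simpa [zpowersHom_apply] using SemidirectProduct.inl_injective h3

/-- No nontrivial element of the free group of rank `k` is mapped to a diagonal matrix: otherwise
its image would commute with that of `a`. -/
theorem freeRep_conjEmbedding_ne_zero {k : ℕ} {w : FreeGroup (Fin k)} (hw : w ≠ 1) :
    (freeRep (conjEmbedding k w) : Matrix (Fin 2) (Fin 2) ℂ) 1 0 ≠ 0 := by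
  intro h
  apply hw
  apply eq_one_of_commute_conjEmbedding
  apply freeRep_injective
  have := commute_diagUnitary _ h
  have h2 : freeRep (FreeGroup.of false) = diagUnitary := by simp [freeRep]
  rw [map_mul, map_mul, h2]
  exact this

/-! ### Denominators -/

/-- The entries of `5 ^ e * t` are Gaussian integers. -/
def GaussDenominator (e : ℕ) (t : Matrix.unitaryGroup (Fin 2) ℂ) : Prop :=
  ∃ A : Matrix (Fin 2) (Fin 2) GaussianInt,
    GaussianInt.toComplex.mapMatrix A = (5 ^ e : ℂ) • (t : Matrix (Fin 2) (Fin 2) ℂ)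

namespace GaussDenominator

theorem one : GaussDenominator 0 1 := ⟨1, by simp⟩

theorem mul {e f : ℕ} {s t : Matrix.unitaryGroup (Fin 2) ℂ} (hs : GaussDenominator e s)
    (ht : GaussDenominator f t) : GaussDenominator (e + f) (s * t) := by
  obtain ⟨A, hA⟩ := hs
  obtain ⟨B, hB⟩ := ht
  exact ⟨A * B, by
    rw [map_mul, hA, hB, Matrix.UnitaryGroup.mul_val, smul_mul_smul_comm, pow_add]⟩

theorem mono {e f : ℕ} (h : e ≤ f) {t : Matrix.unitaryGroup (Fin 2) ℂ}
    (ht : GaussDenominator e t) : GaussDenominator f t := by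
  obtain ⟨A, hA⟩ := ht
  obtain ⟨d, rfl⟩ := Nat.exists_eq_add_of_le h
  refine ⟨(5 ^ d : GaussianInt) • A, ?_⟩
  ext i j
  have := congrFun (congrFun hA i) j
  simp only [RingHom.mapMatrix_apply, Matrix.map_apply, Matrix.smul_apply, smul_eq_mul,
    map_mul, map_pow, map_ofNat] at this ⊢
  rw [this, pow_add]; ring

theorem freeRep (g : FreeGroup Bool) : ∃ e, GaussDenominator e (freeRep g) :=
  ⟨_, (g.toWord.map gaussLetter).prod, by
    simpa only [FreeGroup.mk_toWord] using mapMatrix_prod_gaussLetter g.toWord⟩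

theorem isAlgebraic {e : ℕ} {t : Matrix.unitaryGroup (Fin 2) ℂ} (h : GaussDenominator e t)
    (i j : Fin 2) : IsAlgebraic ℚ ((t : Matrix (Fin 2) (Fin 2) ℂ) i j) := by
  obtain ⟨A, hA⟩ := h
  have e1 := congrFun (congrFun hA i) j
  simp only [RingHom.mapMatrix_apply, Matrix.map_apply, Matrix.smul_apply, smul_eq_mul] at e1
  have hI : IsAlgebraic ℚ Complex.I := by
    refine IsAlgebraic.of_pow (n := 2) two_pos ?_
    rw [Complex.I_sq]
    exact (isAlgebraic_one).neg
  have hA' : IsAlgebraic ℚ (GaussianInt.toComplex (A i j)) := by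
    rw [GaussianInt.toComplex_def]
    exact (isAlgebraic_intCast _).add ((isAlgebraic_intCast _).mul hI)
  have h5 : (t : Matrix (Fin 2) (Fin 2) ℂ) i j =
      ((5 : ℕ) : ℂ)⁻¹ ^ e * GaussianInt.toComplex (A i j) := by
    rw [e1, inv_pow]; push_cast; field_simp
  rw [h5]
  exact ((isAlgebraic_natCast 5).inv.pow e).mul hA'

/-- A nonzero Gaussian integer has norm at least one. -/
theorem le_norm_sq {e : ℕ} {t : Matrix.unitaryGroup (Fin 2) ℂ} (h : GaussDenominator e t)
    {i j : Fin 2} (hij : (t : Matrix (Fin 2) (Fin 2) ℂ) i j ≠ 0) :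
    ((25 : ℝ) ^ e)⁻¹ ≤ ‖(t : Matrix (Fin 2) (Fin 2) ℂ) i j‖ ^ 2 := by
  obtain ⟨A, hA⟩ := h
  have e1 := congrFun (congrFun hA i) j
  simp only [RingHom.mapMatrix_apply, Matrix.map_apply, Matrix.smul_apply, smul_eq_mul] at e1
  have hne : A i j ≠ 0 := by
    intro h0
    rw [h0, map_zero] at e1
    exact hij (by simpa using e1.symm)
  have h1 : (1 : ℝ) ≤ ‖GaussianInt.toComplex (A i j)‖ ^ 2 := by
    rw [← Complex.normSq_eq_norm_sq, ← GaussianInt.intCast_real_norm]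
    exact_mod_cast GaussianInt.norm_pos.2 hne
  rw [e1, norm_mul, mul_pow, norm_pow, ← pow_mul, mul_comm e 2, pow_mul] at h1
  rw [inv_le_iff_one_le_mul₀' (by positivity)]
  norm_num at h1 ⊢
  exact h1

end GaussDenominator

end TwoQCFA

/-! ### Expectations and potential functions -/

namespace TwoQCFA

/-- The expectation of a function with values in `[0, ∞]`. -/
noncomputable def expect {X : Type*} (p : PMF X) (f : X → ℝ≥0∞) : ℝ≥0∞ := ∑' x, p x * f x

section expect

variable {X Y : Type*}

theorem expect_pure (x : X) (f : X → ℝ≥0∞) : expect (PMF.pure x) f = f x := by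
  rw [expect, tsum_eq_single x fun y hy => by simp [PMF.pure_apply_of_ne _ _ hy]]
  simp

theorem expect_bind (p : PMF X) (k : X → PMF Y) (f : Y → ℝ≥0∞) :
    expect (p.bind k) f = expect p fun x => expect (k x) f := by
  simp only [expect, PMF.bind_apply, ← ENNReal.tsum_mul_right, ← ENNReal.tsum_mul_left]
  rw [ENNReal.tsum_comm]
  simp only [mul_assoc]

theorem expect_map (p : PMF X) (k : X → Y) (f : Y → ℝ≥0∞) :
    expect (p.map k) f = expect p fun x => f (k x) := by
  rw [← PMF.bind_pure_comp, expect_bind]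
  simp only [Function.comp_apply, expect_pure]

theorem expect_mono {p : PMF X} {f g : X → ℝ≥0∞} (h : ∀ x ∈ p.support, f x ≤ g x) :
    expect p f ≤ expect p g := by
  refine ENNReal.tsum_le_tsum fun x => ?_
  by_cases hx : x ∈ p.support
  · exact mul_le_mul_right (h x hx) _
  · rw [(p.apply_eq_zero_iff x).2 hx]; simp

theorem expect_add (p : PMF X) (f g : X → ℝ≥0∞) :
    expect p (fun x => f x + g x) = expect p f + expect p g := by
  simp only [expect, mul_add, ENNReal.tsum_add]

theorem toOuterMeasure_eq_expect (p : PMF X) (s : Set X) :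
    p.toOuterMeasure s = expect p (s.indicator 1) := by
  classical
  rw [PMF.toOuterMeasure_apply, expect]
  refine tsum_congr fun x => ?_
  by_cases hx : x ∈ s <;> simp [hx]

theorem expect_one (p : PMF X) : expect p (fun _ => 1) = 1 := by
  simp [expect, p.tsum_coe]

end expect

namespace Machine

variable {Q : Type*} [Fintype Q] [DecidableEq Q] {C α : Type*} (M : Machine Q C α)
  (w : List α)

/-- The configuration is not halting. -/
def Running {n : ℕ} (x : Config Q C n) : Prop := x.state ≠ M.cAcc ∧ x.state ≠ M.cRej

variable {M w} in
theorem step_of_not_running {x : Config Q C w.length} (h : ¬ M.Running x) :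
    M.step w x = PMF.pure x := by
  rw [step, if_pos]
  unfold Running at h
  tauto

variable {M w} in
theorem step_of_running {x : Config Q C w.length} (h : M.Running x) :
    M.step w x = act (M.δ x.state (tape w x.head)) x := by
  rw [step, if_neg]
  unfold Running at h
  tauto

/-- A property of configurations that holds initially and is preserved by the steps of nonzero
probability. -/
structure Invariant (I : Config Q C w.length → Prop) : Prop where
  init : I (M.init w)
  step : ∀ x, I x → M.Running x → ∀ y ∈ (M.step w x).support, I y

variable {M w}

theorem Invariant.run {I : Config Q C w.length → Prop} (hI : M.Invariant w I) (t : ℕ) :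
    ∀ x ∈ (M.run w t).support, I x := by
  induction t with
  | zero => intro x hx; simp only [Machine.run, PMF.support_pure, Set.mem_singleton_iff] at hx
            rw [hx]; exact hI.init
  | succ t ih =>
    intro y hy
    simp only [Machine.run, PMF.mem_support_bind_iff] at hy
    obtain ⟨x, hx, hy⟩ := hy
    by_cases hr : M.Running x
    · exact hI.step x (ih x hx) hr y hy
    · rw [step_of_not_running hr, PMF.mem_support_pure_iff] at hy
      rw [hy]; exact ih x hx

/-- A potential that drops by at least one in expectation in every step bounds the expected
running time. -/
theorem expectedTime_le {I : Config Q C w.length → Prop} (hI : M.Invariant w I)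
    (V : Config Q C w.length → ℝ≥0∞)
    (hV : ∀ x, I x → M.Running x → 1 + expect (M.step w x) V ≤ V x) :
    M.expectedTime w ≤ V (M.init w) := by
  have key : ∀ T, ∑ t ∈ Finset.range T, (M.run w t).toOuterMeasure {x | M.Running x} +
      expect (M.run w T) V ≤ V (M.init w) := by
    intro T
    induction T with
    | zero => simp [run, expect_pure]
    | succ T ih =>
      refine le_trans ?_ ih
      rw [Finset.sum_range_succ, add_assoc]
      gcongr
      rw [toOuterMeasure_eq_expect, Machine.run, expect_bind, ← expect_add]
      refine expect_mono fun x hx => ?_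
      by_cases hr : M.Running x
      · simpa [hr] using hV x (hI.run T x hx) hr
      · simp [hr, step_of_not_running hr, expect_pure]
  refine ENNReal.tsum_le_of_sum_range_le fun T => le_trans ?_ (key T)
  exact le_self_add

/-- A potential that does not grow in expectation and is at least one in the accepting
configurations bounds the probability of acceptance. -/
theorem acceptProb_le {I : Config Q C w.length → Prop} (hI : M.Invariant w I)
    (U : Config Q C w.length → ℝ≥0∞) (hacc : ∀ x, x.state = M.cAcc → 1 ≤ U x)
    (hU : ∀ x, I x → M.Running x → expect (M.step w x) U ≤ U x) :
    M.acceptProb w ≤ U (M.init w) := by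
  have key : ∀ t, expect (M.run w t) U ≤ U (M.init w) := by
    intro t
    induction t with
    | zero => simp [run, expect_pure]
    | succ t ih =>
      refine le_trans ?_ ih
      rw [Machine.run, expect_bind]
      refine expect_mono fun x hx => ?_
      by_cases hr : M.Running x
      · exact hU x (hI.run t x hx) hr
      · simp [step_of_not_running hr, expect_pure]
  refine iSup_le fun t => le_trans ?_ (key t)
  rw [toOuterMeasure_eq_expect]
  refine expect_mono fun x _ => ?_
  by_cases hx : x.state = M.cAcc <;> simp [hx, hacc]

theorem rejectProb_eq_zero {I : Config Q C w.length → Prop} (hI : M.Invariant w I)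
    (h : ∀ x, I x → x.state ≠ M.cRej) : M.rejectProb w = 0 := by
  simp only [rejectProb, ENNReal.iSup_eq_zero, PMF.toOuterMeasure_apply_eq_zero_iff]
  intro t
  rw [Set.disjoint_left]
  exact fun x hx => h x (hI.run t x hx)

theorem monotone_run_of_not_running {s : Set (Config Q C w.length)}
    (hs : ∀ x ∈ s, ¬ M.Running x) : Monotone fun t => (M.run w t).toOuterMeasure s := by
  refine monotone_nat_of_le_succ fun t => ?_
  rw [toOuterMeasure_eq_expect, toOuterMeasure_eq_expect, Machine.run, expect_bind]
  refine expect_mono fun x _ => ?_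
  by_cases hx : x ∈ s
  · rw [step_of_not_running (hs x hx), expect_pure]
  · simp [hx]

theorem acceptProb_add_rejectProb (h : M.expectedTime w ≠ ∞) :
    M.acceptProb w + M.rejectProb w = 1 := by
  rw [acceptProb, rejectProb, ENNReal.iSup_add_iSup_of_monotone
    (monotone_run_of_not_running (s := {x | x.state = M.cAcc}) fun x hx => fun hr => hr.1 hx)
    (monotone_run_of_not_running (s := {x | x.state = M.cRej}) fun x hx => fun hr => hr.2 hx)]
  have hsum : ∀ t, (M.run w t).toOuterMeasure {x | x.state = M.cAcc} +
      (M.run w t).toOuterMeasure {x | x.state = M.cRej} +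
      (M.run w t).toOuterMeasure {x | x.state ≠ M.cAcc ∧ x.state ≠ M.cRej} = 1 := by
    intro t
    simp only [toOuterMeasure_eq_expect, ← expect_add]
    rw [← expect_one (M.run w t)]
    congr 1
    ext x
    by_cases h1 : x.state = M.cAcc
    · simp [h1, M.acc_ne_rej]
    · by_cases h2 : x.state = M.cRej
      · simp [h2, M.acc_ne_rej.symm]
      · simp [h1, h2]
  have h0 := ENNReal.tendsto_atTop_zero_of_tsum_ne_top h
  apply le_antisymm
  · exact iSup_le fun t => by rw [← hsum t]; exact le_self_add
  · refine ENNReal.le_of_forall_pos_le_add fun ε hε _ => ?_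
    rw [ENNReal.tendsto_atTop_zero] at h0
    obtain ⟨t, ht⟩ := h0 ε (by exact_mod_cast hε)
    rw [← hsum t]
    gcongr
    · exact le_iSup (fun t => (M.run w t).toOuterMeasure {x | x.state = M.cAcc} +
        (M.run w t).toOuterMeasure {x | x.state = M.cRej}) t
    · exact ht t le_rfl

end Machine

/-! ### Measuring one qubit -/

/-- The measurement of a single qubit in the computational basis: the machine goes on with `o₀` if
the result is `0`, and with `o₁` if it is `1`. -/
def Action.readout {C : Type*} (o₀ o₁ : C × HeadMove) : Action (Fin 2) C :=
  .measurement ⊥ fun b => if 0 ∈ b.1 then o₀ else o₁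

section readout

variable {C : Type*} {n : ℕ} (o₀ o₁ : C × HeadMove) (x : Config (Fin 2) C n)

theorem mem_support_act_readout {y : Config (Fin 2) C n}
    (hy : y ∈ (Machine.act (Action.readout o₀ o₁) x).support) :
    (x.register.amp 0 ≠ 0 ∧ y.state = o₀.1 ∧ y.head = moveHead x.head o₀.2 ∧
      y.register.amp 1 = 0) ∨
    (x.register.amp 1 ≠ 0 ∧ y.state = o₁.1 ∧ y.head = moveHead x.head o₁.2 ∧
      y.register.amp 0 = 0) := by
  simp only [Machine.act, Action.readout, PMF.mem_support_map_iff] at hy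
  obtain ⟨⟨b, hb⟩, hw, rfl⟩ := hy
  have hw' : x.register.weight b ≠ 0 := by
    intro h0
    simp [Superposition.measure, h0] at hw
  rw [Finpartition.mem_bot_iff] at hb
  obtain ⟨q, -, rfl⟩ := hb
  have hq : x.register.amp q ≠ 0 := by
    intro h0; simp [Superposition.weight, h0] at hw'
  fin_cases q
  · left
    refine ⟨hq, by simp, by simp, ?_⟩
    simp only [Superposition.collapse]
    rw [dif_neg hw']
    simp
  · right
    refine ⟨hq, by simp, by simp, ?_⟩
    simp only [Superposition.collapse]
    rw [dif_neg hw']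
    simp

/-- The expectation after a measurement of a function of the classical state and the head. -/
theorem expect_act_readout (v : C → Fin (n + 2) → ℝ) (hv : ∀ c i, 0 ≤ v c i) :
    expect (Machine.act (Action.readout o₀ o₁) x)
        (fun y => ENNReal.ofReal (v y.state y.head)) =
      ENNReal.ofReal (‖x.register.amp 0‖ ^ 2 * v o₀.1 (moveHead x.head o₀.2) +
        ‖x.register.amp 1‖ ^ 2 * v o₁.1 (moveHead x.head o₁.2)) := by
  simp only [Machine.act, Action.readout]
  rw [expect_map, expect, tsum_fintype]
  simp only [Superposition.measure, PMF.ofFintype_apply]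
  rw [Finset.sum_coe_sort (⊥ : Finpartition (Finset.univ : Finset (Fin 2))).parts
    (fun b => ENNReal.ofReal (x.register.weight b) *
      ENNReal.ofReal (v (if 0 ∈ b then o₀ else o₁).1
        (moveHead x.head (if 0 ∈ b then o₀ else o₁).2))), Finpartition.parts_bot,
    Finset.sum_map, Fin.sum_univ_two, ENNReal.ofReal_add (mul_nonneg (by positivity) (hv _ _))
      (mul_nonneg (by positivity) (hv _ _)),
    ENNReal.ofReal_mul (by positivity), ENNReal.ofReal_mul (by positivity)]
  simp [Superposition.weight]

theorem norm_amp_sq_add (ψ : Superposition (Fin 2)) : ‖ψ.amp 0‖ ^ 2 + ‖ψ.amp 1‖ ^ 2 = 1 := by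
  simpa using ψ.norm_one

end readout

end TwoQCFA

/-! ### The machine -/

namespace TwoQCFA

/-- A finite automaton with states in `Q` together with `m + 1` assignments of a unitary matrix to
every transition: the data from which the machine `TestSystem.machine` is built. -/
structure TestSystem (m : ℕ) (Q α : Type*) where
  base : Q
  next : Q → α → Q
  gate : Fin (m + 1) → Q → α → Matrix.unitaryGroup (Fin 2) ℂ

/-- The classical states of `TestSystem.machine`. In `scan i q` the head moves to the right and the
`i`-th gates are applied; in `back i` it returns after the `i`-th test was passed; `flip` and `look`
toss a coin in every cell; in `fail` the head returns after a coin came out wrong, and a new round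
begins. -/
inductive Control (m : ℕ) (Q : Type*) where
  | scan (i : Fin (m + 1)) (q : Q)
  | back (i : Fin (m + 1))
  | flip
  | look
  | fail
  | acc
  | rej

instance (m : ℕ) (Q : Type*) [Finite Q] : Finite (Control m Q) := by
  let f : (Fin (m + 1) × Q) ⊕ Fin (m + 1) ⊕ Fin 5 → Control m Q := fun x =>
    match x with
    | .inl (i, q) => .scan i q
    | .inr (.inl i) => .back i
    | .inr (.inr 0) => .flip
    | .inr (.inr 1) => .look
    | .inr (.inr 2) => .fail
    | .inr (.inr 3) => .acc
    | .inr (.inr 4) => .rej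
  refine Finite.of_surjective f ?_
  rintro (⟨i, q⟩ | i | _ | _ | _ | _ | _)
  · exact ⟨.inl (i, q), rfl⟩
  · exact ⟨.inr (.inl i), rfl⟩
  · exact ⟨.inr (.inr 0), rfl⟩
  · exact ⟨.inr (.inr 1), rfl⟩
  · exact ⟨.inr (.inr 2), rfl⟩
  · exact ⟨.inr (.inr 3), rfl⟩
  · exact ⟨.inr (.inr 4), rfl⟩

namespace TestSystem

variable {m : ℕ} {Q α : Type*} (T : TestSystem m Q α)

/-- The state of the automaton after reading a word. -/
def stateAfter (w : List α) : Q := w.foldl T.next T.base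

/-- The product of the `i`-th gates along a word read from the state `q`; later gates stand further
to the left. -/
noncomputable def gateFrom (i : Fin (m + 1)) : Q → List α → Matrix.unitaryGroup (Fin 2) ℂ
  | _, [] => 1
  | q, a :: w => gateFrom i (T.next q a) w * T.gate i q a

/-- The product of the `i`-th gates along a word read from the initial state. -/
noncomputable def gateAfter (i : Fin (m + 1)) (w : List α) : Matrix.unitaryGroup (Fin 2) ℂ :=
  T.gateFrom i T.base w

theorem stateAfter_append (w : List α) (a : α) :
    T.stateAfter (w ++ [a]) = T.next (T.stateAfter w) a := by
  simp [stateAfter]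

theorem gateFrom_append (i : Fin (m + 1)) (q : Q) (w : List α) (a : α) :
    T.gateFrom i q (w ++ [a]) = T.gate i (w.foldl T.next q) a * T.gateFrom i q w := by
  induction w generalizing q with
  | nil => simp [gateFrom]
  | cons b w ih => simp [gateFrom, ih, mul_assoc]

theorem gateAfter_append (i : Fin (m + 1)) (w : List α) (a : α) :
    T.gateAfter i (w ++ [a]) = T.gate i (T.stateAfter w) a * T.gateAfter i w :=
  T.gateFrom_append i T.base w a

open Classical in
/-- The probability that the `i`-th test is passed on the input `w`. -/
noncomputable def passProb (w : List α) (i : Fin (m + 1)) : ℝ :=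
  if T.stateAfter w = T.base then
    1 - ‖(T.gateAfter i w : Matrix (Fin 2) (Fin 2) ℂ) 1 0‖ ^ 2
  else 0

/-- The transformation that turns `|0⟩` into a coin with probability `p` of `0`. -/
noncomputable def coin (p : unitInterval) : Matrix.unitaryGroup (Fin 2) ℂ :=
  rotation (Real.sqrt p) (Real.sqrt (1 - p)) (by
    rw [Real.sq_sqrt p.2.1, Real.sq_sqrt (by linarith [p.2.2])]; ring)

open Classical in
/-- In every round the machine makes the tests `0, …, m`, and rejects if one of them fails: the
`i`-th test applies the `i`-th gates along the input to the state `|0⟩`, and is passed if then the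
automaton is in the state `base` and the register is found in the state `|0⟩`. After the tests the
machine tosses in every cell of the tape a coin that comes out right with probability `p`; it
accepts if all of them do, and begins a new round otherwise. -/
noncomputable def machine (p : unitInterval) : Machine (Fin 2) (Control m Q) α where
  δ c γ := match c, γ with
    | .scan i q, .leftEnd => .unitary 1 (.scan i q) .right
    | .scan i q, .letter a => .unitary (T.gate i q a) (.scan i (T.next q a)) .right
    | .scan i q, .rightEnd =>
      .readout (if q = T.base then (.back i, .left) else (.rej, .stay)) (.rej, .stay)
    | .back i, .leftEnd =>
      .unitary 1 (if i = Fin.last m then .flip else .scan (i + 1) T.base) .stay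
    | .back i, .letter _ => .unitary 1 (.back i) .left
    | .back i, .rightEnd => .unitary 1 (.back i) .left
    | .flip, _ => .unitary (coin p) .look .stay
    | .look, .leftEnd => .readout (.flip, .right) (.fail, .stay)
    | .look, .letter _ => .readout (.flip, .right) (.fail, .stay)
    | .look, .rightEnd => .readout (.acc, .stay) (.fail, .stay)
    | .fail, .leftEnd => .unitary (rotation 0 1 (by norm_num)) (.scan 0 T.base) .stay
    | .fail, .letter _ => .unitary 1 .fail .left
    | .fail, .rightEnd => .unitary 1 .fail .left
    | .acc, _ => .unitary 1 .acc .stay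
    | .rej, _ => .unitary 1 .rej .stay
  qStart := 0
  cStart := .scan 0 T.base
  cAcc := .acc
  cRej := .rej
  acc_ne_rej := by simp
  not_left c _ _ := by
    cases c <;> simp [Action.moves, Action.readout]
    intros
    split_ifs <;> simp
  not_right c _ _ := by
    cases c <;> simp [Action.moves, Action.readout]
    all_goals
      intros
      split_ifs <;> simp

variable {T}

theorem hasAmplitudesIn_machine (p : unitInterval) (hp : IsAlgebraic ℚ ((p : ℝ) : ℂ))
    (hT : ∀ i q a j k, IsAlgebraic ℚ ((T.gate i q a : Matrix (Fin 2) (Fin 2) ℂ) j k)) :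
    (T.machine p).HasAmplitudesIn {z : ℂ | IsAlgebraic ℚ z} := by
  have hone : ∀ j k, IsAlgebraic ℚ
      (((1 : Matrix.unitaryGroup (Fin 2) ℂ) : Matrix (Fin 2) (Fin 2) ℂ) j k) := by
    intro j k
    rw [Matrix.UnitaryGroup.one_val, Matrix.one_apply]
    split_ifs
    exacts [isAlgebraic_one, isAlgebraic_zero]
  have hrot : ∀ (c s : ℝ) (h : c ^ 2 + s ^ 2 = 1), IsAlgebraic ℚ (c : ℂ) → IsAlgebraic ℚ (s : ℂ) →
      ∀ j k, IsAlgebraic ℚ ((rotation c s h : Matrix (Fin 2) (Fin 2) ℂ) j k) := by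
    intro c s h hc hs j k
    fin_cases j <;> fin_cases k <;> simp [rotation, hc, hs, hs.neg]
  have hsqrt : ∀ r : ℝ, 0 ≤ r → IsAlgebraic ℚ (r : ℂ) → IsAlgebraic ℚ ((Real.sqrt r : ℝ) : ℂ) := by
    intro r hr h
    refine IsAlgebraic.of_pow (n := 2) two_pos ?_
    rwa [← Complex.ofReal_pow, Real.sq_sqrt hr]
  have hcoin : ∀ j k, IsAlgebraic ℚ ((coin p : Matrix (Fin 2) (Fin 2) ℂ) j k) := by
    refine hrot _ _ _ (hsqrt _ p.2.1 hp) (hsqrt _ (by linarith [p.2.2]) ?_)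
    rw [Complex.ofReal_sub, Complex.ofReal_one]
    exact isAlgebraic_one.sub hp
  have hX := hrot 0 1 (by norm_num) (by simpa using isAlgebraic_zero)
    (by simpa using isAlgebraic_one)
  intro c γ t c' h _ _ hδ
  cases c <;> cases γ <;> simp only [machine, Action.readout, Action.unitary.injEq, reduceCtorEq]
    at hδ <;> obtain ⟨rfl, -, -⟩ := hδ <;>
    first | exact hone | exact hT _ _ _ | exact hcoin | exact hX

end TestSystem

theorem tape_cases {α : Type*} (w : List α) (h : Fin (w.length + 2)) :
    (h.1 = 0 ∧ tape w h = .leftEnd) ∨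
    (∃ a, 1 ≤ h.1 ∧ h.1 ≤ w.length ∧ tape w h = .letter a ∧
      w.take h.1 = w.take (h.1 - 1) ++ [a]) ∨
    (h.1 = w.length + 1 ∧ tape w h = .rightEnd) := by
  by_cases h0 : h.1 = 0
  · exact .inl ⟨h0, by simp [tape, h0]⟩
  by_cases h1 : h.1 - 1 < w.length
  · refine .inr (.inl ⟨w[h.1 - 1], by omega, by omega, by simp [tape, h0, h1], ?_⟩)
    rw [List.take_concat_get' w (h.1 - 1) h1]
    congr 1; omega
  · exact .inr (.inr ⟨by omega, by simp [tape, h0, h1]⟩)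

namespace TestSystem

variable {m : ℕ} {Q α : Type*} (T : TestSystem m Q α) (p : unitInterval) (w : List α)

/-- The reachable configurations of the machine on the input `w`; the rejecting state is reachable
only if some test is not passed with certainty. -/
def Reachable (x : Config (Fin 2) (Control m Q) w.length) : Prop :=
  match x.state with
  | .scan i q => q = T.stateAfter (w.take (x.head.1 - 1)) ∧
      ∃ φ : Superposition (Fin 2), φ.amp 1 = 0 ∧
        x.register = φ.apply (T.gateAfter i (w.take (x.head.1 - 1)))
  | .back _ => x.register.amp 1 = 0
  | .flip => x.register.amp 1 = 0
  | .look => ‖x.register.amp 0‖ ^ 2 = p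
  | .fail => x.register.amp 0 = 0
  | .acc => True
  | .rej => ∃ i, T.passProb w i ≠ 1

variable {T p w}

theorem apply_one (ψ : Superposition (Fin 2)) : ψ.apply 1 = ψ := by
  ext1; simp [Superposition.apply]

theorem apply_mul (s t : Matrix.unitaryGroup (Fin 2) ℂ) (ψ : Superposition (Fin 2)) :
    ψ.apply (s * t) = (ψ.apply t).apply s := by
  ext1; simp only [Superposition.apply, Matrix.UnitaryGroup.mul_val, Matrix.mulVec_mulVec]

theorem apply_amp (t : Matrix.unitaryGroup (Fin 2) ℂ) (ψ : Superposition (Fin 2)) (k : Fin 2) :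
    (ψ.apply t).amp k = (t : Matrix (Fin 2) (Fin 2) ℂ) k 0 * ψ.amp 0 +
      (t : Matrix (Fin 2) (Fin 2) ℂ) k 1 * ψ.amp 1 := by
  simp only [Superposition.apply, Matrix.mulVec, dotProduct, Fin.sum_univ_two]

theorem norm_amp_zero {ψ : Superposition (Fin 2)} (h : ψ.amp 1 = 0) : ‖ψ.amp 0‖ = 1 := by
  have := norm_amp_sq_add ψ
  rw [h, norm_zero] at this
  nlinarith [norm_nonneg (ψ.amp 0)]

theorem apply_amp_one_of_amp_one (t : Matrix.unitaryGroup (Fin 2) ℂ) {ψ : Superposition (Fin 2)}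
    (h : ψ.amp 1 = 0) :
    ‖(ψ.apply t).amp 1‖ ^ 2 = ‖(t : Matrix (Fin 2) (Fin 2) ℂ) 1 0‖ ^ 2 := by
  rw [apply_amp, h, mul_zero, add_zero, norm_mul, norm_amp_zero h, mul_one]

theorem amp_of_reachable_scan {i : Fin (m + 1)} {q : Q} {h : Fin (w.length + 2)}
    {ψ : Superposition (Fin 2)} (hx : T.Reachable p w ⟨.scan i q, h, ψ⟩)
    (hh : h.1 = w.length + 1) :
    q = T.stateAfter w ∧
      ‖ψ.amp 1‖ ^ 2 = ‖(T.gateAfter i w : Matrix (Fin 2) (Fin 2) ℂ) 1 0‖ ^ 2 := by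
  obtain ⟨hq, φ, hφ, e⟩ := hx
  simp only [hh, Nat.add_sub_cancel, List.take_length] at hq e
  exact ⟨hq, by rw [e, apply_amp_one_of_amp_one _ hφ]⟩

theorem mem_support_act_unitary {C : Type*} {n : ℕ} {t : Matrix.unitaryGroup (Fin 2) ℂ} {c : C}
    {d : HeadMove} {x y : Config (Fin 2) C n}
    (hy : y ∈ (Machine.act (.unitary t c d) x).support) :
    y = ⟨c, moveHead x.head d, x.register.apply t⟩ := by
  simpa [Machine.act] using hy

theorem moveHead_right {n : ℕ} {h : Fin (n + 2)} (hh : h.1 ≤ n) :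
    (moveHead h .right).1 = h.1 + 1 := by
  simp only [moveHead]; omega

theorem apply_one_mem (ψ : Superposition (Fin 2)) (w : List α) (i : Fin (m + 1)) :
    ψ = ψ.apply (T.gateAfter i (w.take 0)) := by
  simp [gateAfter, gateFrom, apply_one]

theorem reachable_invariant : (T.machine p).Invariant w (T.Reachable p w) := by
  constructor
  · exact ⟨rfl, Superposition.basis 0, by simp [Superposition.basis],
      apply_one_mem _ _ _⟩
  rintro ⟨c, h, ψ⟩ hx hr y hy
  rw [Machine.step_of_running hr] at hy
  have ht := tape_cases w h
  cases c with
  | scan i q =>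
    obtain ⟨h0, ht⟩ | ⟨a, h1, h2, ht, hta⟩ | ⟨h1, ht⟩ := ht
    · simp only [ht, machine] at hy
      rw [mem_support_act_unitary hy, apply_one]
      simpa only [Reachable, moveHead_right (show h.1 ≤ w.length by omega), h0] using hx
    · simp only [ht, machine] at hy
      rw [mem_support_act_unitary hy]
      obtain ⟨hq, φ, hφ, e⟩ := hx
      simp only at hq e
      simp only [Reachable, moveHead_right h2, Nat.add_sub_cancel, hta]
      rw [stateAfter_append, gateAfter_append, ← hq]
      exact ⟨rfl, φ, hφ, by rw [e, apply_mul]⟩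
    · obtain ⟨hq, hamp⟩ := amp_of_reachable_scan hx h1
      simp only [ht, machine] at hy
      obtain ⟨hne, hs, -, ha⟩ | ⟨hne, hs, -, ha⟩ := mem_support_act_readout _ _ _ hy
      · by_cases hb : q = T.base
        · simp only [hb, if_true] at hs
          simp only [Reachable, hs, ha]
        · simp only [hb, if_false] at hs
          simp only [Reachable, hs]
          refine ⟨i, ?_⟩
          rw [passProb, ← hq, if_neg hb]
          exact zero_ne_one
      · simp only at hs
        simp only [Reachable, hs]
        refine ⟨i, ?_⟩
        rw [passProb, ← hamp]
        have : 0 < ‖ψ.amp 1‖ := norm_pos_iff.2 hne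
        split_ifs
        · have : 0 < ‖ψ.amp 1‖ ^ 2 := by positivity
          linarith
        · exact zero_ne_one
  | back i =>
    obtain ⟨h0, ht⟩ | ⟨a, h1, h2, ht, hta⟩ | ⟨h1, ht⟩ := ht <;> simp only [ht, machine] at hy <;>
      rw [mem_support_act_unitary hy, apply_one]
    · by_cases hi : i = Fin.last m
      · simp only [hi, if_true]; exact hx
      · simp only [hi, if_false]
        simp only [Reachable, moveHead, h0]
        exact ⟨rfl, ψ, hx, apply_one_mem _ _ _⟩
    · exact hx
    · exact hx
  | flip =>
    simp only [machine] at hy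
    rw [mem_support_act_unitary hy]
    have hx' : ψ.amp 1 = 0 := hx
    simp only [Reachable, apply_amp, hx', coin, rotation]
    simp [norm_amp_zero hx', Real.sq_sqrt p.2.1]
  | look =>
    obtain ⟨h0, ht⟩ | ⟨a, h1, h2, ht, hta⟩ | ⟨h1, ht⟩ := ht <;> simp only [ht, machine] at hy <;>
      obtain ⟨-, hs, -, ha⟩ | ⟨-, hs, -, ha⟩ := mem_support_act_readout _ _ _ hy <;>
      simp only at hs <;> simp only [Reachable, hs, ha]
  | fail =>
    obtain ⟨h0, ht⟩ | ⟨a, h1, h2, ht, hta⟩ | ⟨h1, ht⟩ := ht <;> simp only [ht, machine] at hy <;>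
      rw [mem_support_act_unitary hy]
    · have hx' : ψ.amp 0 = 0 := hx
      simp only [Reachable, moveHead, h0]
      refine ⟨rfl, _, ?_, apply_one_mem _ _ _⟩
      simp [apply_amp, hx', rotation]
    · rw [apply_one]; exact hx
    · rw [apply_one]; exact hx
  | acc => exact absurd rfl hr.1
  | rej => exact absurd rfl hr.2

theorem machine_rejectProb_eq_zero (h : ∀ i, T.passProb w i = 1) :
    (T.machine p).rejectProb w = 0 := by
  refine Machine.rejectProb_eq_zero reachable_invariant fun x hx hs => ?_
  simp only [Reachable, show x.state = .rej from hs] at hx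
  obtain ⟨i, hi⟩ := hx
  exact hi (h i)

variable (T p w) in
/-- A function `v` of the classical state and the head that drops by at least `r` in expectation in
every step on the input `w`. -/
structure Potential (r : ℝ) (v : Control m Q → ℕ → ℝ) : Prop where
  nonneg : ∀ c j, 0 ≤ v c j
  rej : ∀ j, v .rej j = 0
  scan : ∀ i q q' j, j ≤ w.length → r + v (.scan i q') (j + 1) ≤ v (.scan i q) j
  test : ∀ i q, r + T.passProb w i * v (.back i) w.length ≤ v (.scan i q) (w.length + 1)
  back : ∀ i j, j ≤ w.length → r + v (.back i) j ≤ v (.back i) (j + 1)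
  next : ∀ i, i ≠ Fin.last m → r + v (.scan (i + 1) T.base) 0 ≤ v (.back i) 0
  last : r + v .flip 0 ≤ v (.back (Fin.last m)) 0
  flip : ∀ j, j ≤ w.length + 1 → r + v .look j ≤ v .flip j
  look : ∀ j, j ≤ w.length → r + (p * v .flip (j + 1) + (1 - p) * v .fail j) ≤ v .look j
  accept : r + (p * v .acc (w.length + 1) + (1 - p) * v .fail (w.length + 1)) ≤
    v .look (w.length + 1)
  fail : ∀ j, j ≤ w.length → r + v .fail j ≤ v .fail (j + 1)
  restart : r + v (.scan 0 T.base) 0 ≤ v .fail 0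

theorem Potential.expect_step_le {r : ℝ} {v : Control m Q → ℕ → ℝ} (hr : 0 ≤ r)
    (hv : T.Potential p w r v) (x : Config (Fin 2) (Control m Q) w.length)
    (hx : T.Reachable p w x) (hrun : (T.machine p).Running x) :
    ENNReal.ofReal r + expect ((T.machine p).step w x)
      (fun y => ENNReal.ofReal (v y.state y.head.1)) ≤ ENNReal.ofReal (v x.state x.head.1) := by
  have unitary : ∀ {c d t}, (T.machine p).δ x.state (tape w x.head) = .unitary t c d →
      r + v c (moveHead x.head d).1 ≤ v x.state x.head.1 →
      ENNReal.ofReal r + expect ((T.machine p).step w x)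
      (fun y => ENNReal.ofReal (v y.state y.head.1)) ≤ ENNReal.ofReal (v x.state x.head.1) := by
    intro c d t h h'
    rw [Machine.step_of_running hrun, h, Machine.act, expect_pure,
      ← ENNReal.ofReal_add hr (hv.nonneg _ _)]
    exact ENNReal.ofReal_le_ofReal h'
  have readout : ∀ {o₀ o₁}, (T.machine p).δ x.state (tape w x.head) = .readout o₀ o₁ →
      r + (‖x.register.amp 0‖ ^ 2 * v o₀.1 (moveHead x.head o₀.2).1 +
        ‖x.register.amp 1‖ ^ 2 * v o₁.1 (moveHead x.head o₁.2).1) ≤ v x.state x.head.1 →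
      ENNReal.ofReal r + expect ((T.machine p).step w x)
      (fun y => ENNReal.ofReal (v y.state y.head.1)) ≤ ENNReal.ofReal (v x.state x.head.1) := by
    intro o₀ o₁ h h'
    rw [Machine.step_of_running hrun, h,
      expect_act_readout _ _ _ (fun c i => v c i.1) (fun _ _ => hv.nonneg _ _),
      ← ENNReal.ofReal_add hr]
    · exact ENNReal.ofReal_le_ofReal h'
    · have := hv.nonneg o₀.1 (moveHead x.head o₀.2).1
      have := hv.nonneg o₁.1 (moveHead x.head o₁.2).1
      positivity
  obtain ⟨c, h, ψ⟩ := x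
  have hsum := norm_amp_sq_add ψ
  have ht := tape_cases w h
  cases c with
  | scan i q =>
    obtain ⟨h0, ht⟩ | ⟨a, h1, h2, ht, hta⟩ | ⟨h1, ht⟩ := ht
    · refine unitary (by simp only [ht, machine]; rfl) ?_
      rw [moveHead_right (show h.1 ≤ w.length by omega)]
      exact hv.scan _ _ _ _ (by omega)
    · refine unitary (by simp only [ht, machine]; rfl) ?_
      rw [moveHead_right h2]
      exact hv.scan _ _ _ _ h2
    · obtain ⟨hq, hamp⟩ := amp_of_reachable_scan hx h1
      refine readout (by simp only [ht, machine]; rfl) ?_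
      refine le_trans ?_ (h1 ▸ hv.test i q)
      simp only [hv.rej, mul_zero, add_zero]
      rw [passProb, ← hq, ← hamp]
      split_ifs with hb
      · have : ‖ψ.amp 0‖ ^ 2 = 1 - ‖ψ.amp 1‖ ^ 2 := by linarith
        rw [this]
        simp [moveHead, h1]
      · simp [hv.rej]
  | back i =>
    obtain ⟨h0, ht⟩ | ⟨a, h1, h2, ht, hta⟩ | ⟨h1, ht⟩ := ht <;>
      refine unitary (by simp only [ht, machine]; rfl) ?_
    · simp only [moveHead, h0]
      split_ifs with hi
      · rw [hi]; exact hv.last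
      · exact hv.next i hi
    · have := hv.back i (h.1 - 1) (by omega)
      rwa [Nat.sub_add_cancel h1] at this
    · have := hv.back i (h.1 - 1) (by omega)
      rwa [Nat.sub_add_cancel (by omega)] at this
  | flip =>
    refine unitary (by simp only [machine]; rfl) ?_
    exact hv.flip _ (by have := h.2; omega)
  | look =>
    have h0 : ‖ψ.amp 0‖ ^ 2 = p := hx
    have h1 : ‖ψ.amp 1‖ ^ 2 = 1 - p := by linarith
    obtain ⟨h0, ht⟩ | ⟨a, h1, h2, ht, hta⟩ | ⟨h1, ht⟩ := ht <;>
      refine readout (by simp only [ht, machine]; rfl) ?_ <;> simp only [*]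
    · rw [moveHead_right (by omega)]
      simp only [moveHead, h0]
      exact hv.look 0 (by omega)
    · rw [moveHead_right (by omega)]
      exact hv.look _ h2
    · simp only [moveHead, h1]
      exact hv.accept
  | fail =>
    obtain ⟨h0, ht⟩ | ⟨a, h1, h2, ht, hta⟩ | ⟨h1, ht⟩ := ht <;>
      refine unitary (by simp only [ht, machine]; rfl) ?_
    · simp only [moveHead, h0]
      exact hv.restart
    · have := hv.fail (h.1 - 1) (by omega)
      rwa [Nat.sub_add_cancel h1] at this
    · have := hv.fail (h.1 - 1) (by omega)
      rwa [Nat.sub_add_cancel (by omega)] at this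
  | acc => exact absurd rfl hrun.1
  | rej => exact absurd rfl hrun.2

theorem Potential.expectedTime_le {v : Control m Q → ℕ → ℝ} (hv : T.Potential p w 1 v) :
    (T.machine p).expectedTime w ≤ ENNReal.ofReal (v (.scan 0 T.base) 0) :=
  Machine.expectedTime_le reachable_invariant
    (fun y => ENNReal.ofReal (v y.state y.head.1)) fun x hx hr => by
      simpa using hv.expect_step_le zero_le_one x hx hr

theorem Potential.acceptProb_le {v : Control m Q → ℕ → ℝ} (hv : T.Potential p w 0 v)
    (hacc : ∀ j, 1 ≤ v .acc j) :
    (T.machine p).acceptProb w ≤ ENNReal.ofReal (v (.scan 0 T.base) 0) := by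
  refine Machine.acceptProb_le reachable_invariant
    (fun y => ENNReal.ofReal (v y.state y.head.1)) (fun x hx => ?_) fun x hx hr => by
      simpa using hv.expect_step_le le_rfl x hx hr
  rw [show x.state = .acc from hx, ENNReal.one_le_ofReal]
  exact hacc _

end TestSystem

end TwoQCFA

/-! ### The two potentials of the machine -/

namespace TwoQCFA

namespace TestSystem

variable {m : ℕ} {Q α : Type*} {T : TestSystem m Q α} {p : unitInterval} {w : List α}

theorem passProb_le_one (i : Fin (m + 1)) : T.passProb w i ≤ 1 := by
  rw [passProb]
  split_ifs
  · linarith [sq_nonneg ‖(T.gateAfter i w : Matrix (Fin 2) (Fin 2) ℂ) 1 0‖]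
  · exact zero_le_one

/-- A bound on the number of steps that the machine still makes in the current round, on a tape
with `N` cells. -/
def rank (N : ℕ) : Control m Q → ℕ → ℕ
  | .scan i _, j => 3 * N + 2 + (m - i) * (2 * N + 1) + (2 * N - j)
  | .back i, j => 3 * N + 2 + (m - i) * (2 * N + 1) + j
  | .flip, j => 2 * (N - j) + N + 1
  | .look, j => 2 * (N - j) + N
  | .fail, j => j + 1
  | .acc, _ => 0
  | .rej, _ => 0

/-- The probability that all coins of the current round come out right, provided that the tests
which are still to be made are passed. -/
noncomputable def luck (p : unitInterval) (N : ℕ) : Control m Q → ℕ → ℝ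
  | .scan _ _, _ => (p : ℝ) ^ N
  | .back _, _ => (p : ℝ) ^ N
  | .flip, j => (p : ℝ) ^ (N - j)
  | .look, j => (p : ℝ) ^ (N - j)
  | .fail, _ => 0
  | .acc, _ => 1
  | .rej, _ => 1

theorem luck_le_one (N : ℕ) (c : Control m Q) (j : ℕ) : luck p N c j ≤ 1 := by
  cases c <;> simp only [luck, le_refl, zero_le_one, pow_le_one₀ p.2.1 p.2.2]

theorem mul_pow_sub (N j : ℕ) (h : j + 1 ≤ N) :
    (p : ℝ) * (p : ℝ) ^ (N - (j + 1)) = (p : ℝ) ^ (N - j) := by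
  rw [← pow_succ']; congr 1; omega

/-- A round is followed by another one with probability at most `1 - p ^ N`, so that the number of
rounds contributes at most a factor `p ^ (-N)` to the expected running time. -/
theorem potential_time (hp : 0 < (p : ℝ)) :
    T.Potential p w 1 fun c j => rank (w.length + 2) c j +
      rank (w.length + 2) (.scan 0 T.base : Control m Q) 0 / (p : ℝ) ^ (w.length + 2) *
        (1 - luck p (w.length + 2) c j) := by
  set s₀ := rank (w.length + 2) (.scan 0 T.base : Control m Q) 0 with hs₀
  set A : ℝ := s₀ / (p : ℝ) ^ (w.length + 2) with hA
  have hA0 : 0 ≤ A := by positivity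
  have hδ : A * (p : ℝ) ^ (w.length + 2) = s₀ := by rw [hA]; field_simp
  have hrank : ∀ {c c' : Control m Q} {j j' : ℕ},
      rank (w.length + 2) c' j' + 1 ≤ rank (w.length + 2) c j →
      (rank (w.length + 2) c' j' : ℝ) + 1 ≤ rank (w.length + 2) c j := by
    intro c c' j j' h; exact_mod_cast h
  have coin : ∀ {c₀ c₁ c : Control m Q} {j₀ j₁ j : ℕ},
      rank (w.length + 2) c₀ j₀ + 1 ≤ rank (w.length + 2) c j →
      rank (w.length + 2) c₁ j₁ + 1 ≤ rank (w.length + 2) c j →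
      luck p (w.length + 2) c j = p * luck p (w.length + 2) c₀ j₀ +
        (1 - p) * luck p (w.length + 2) c₁ j₁ →
      1 + ((p : ℝ) * (rank (w.length + 2) c₀ j₀ + A * (1 - luck p (w.length + 2) c₀ j₀)) +
        (1 - p) * (rank (w.length + 2) c₁ j₁ + A * (1 - luck p (w.length + 2) c₁ j₁))) ≤
      rank (w.length + 2) c j + A * (1 - luck p (w.length + 2) c j) := by
    intro c₀ c₁ c j₀ j₁ j h₀ h₁ h
    have h0 := mul_le_mul_of_nonneg_left (hrank h₀) p.2.1
    have h1 := mul_le_mul_of_nonneg_left (hrank h₁) (sub_nonneg.2 p.2.2)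
    rw [h]
    linarith
  have move : ∀ {c c' : Control m Q} {j j' : ℕ},
      rank (w.length + 2) c' j' + 1 ≤ rank (w.length + 2) c j →
      luck p (w.length + 2) c j = luck p (w.length + 2) c' j' →
      1 + ((rank (w.length + 2) c' j' : ℝ) + A * (1 - luck p (w.length + 2) c' j')) ≤
      rank (w.length + 2) c j + A * (1 - luck p (w.length + 2) c j) := by
    intro c c' j j' h e
    rw [e]
    linarith [hrank h]
  refine
    { nonneg := fun c j => ?_
      rej := fun j => by simp [rank, luck]
      scan := fun i q q' j hj => move (by simp only [rank]; omega) rfl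
      test := fun i q => ?_
      back := fun i j hj => move (by simp only [rank]; omega) rfl
      next := fun i hi => move ?_ rfl
      last := move (by simp only [rank]; omega) rfl
      flip := fun j hj => move (by simp only [rank]; omega) rfl
      look := fun j hj => coin (by simp only [rank]; omega) (by simp only [rank]; omega) ?_
      accept := coin (by simp only [rank]; omega) (by simp only [rank]; omega) ?_
      fail := fun j hj => move (by simp only [rank]; omega) rfl
      restart := ?_ }
  · have := mul_nonneg hA0 (sub_nonneg.2 (luck_le_one (p := p) (w.length + 2) c j))
    positivity
  · have h1 : (rank (w.length + 2) (.back i : Control m Q) w.length : ℝ) + 1 ≤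
        rank (w.length + 2) (.scan i q : Control m Q) (w.length + 1) :=
      hrank (by simp only [rank]; omega)
    have h2 := mul_nonneg hA0 (sub_nonneg.2
      (luck_le_one (p := p) (w.length + 2) (.back i : Control m Q) w.length))
    have h3 : 0 ≤ (rank (w.length + 2) (.back i : Control m Q) w.length : ℝ) := by positivity
    have h4 := mul_le_mul_of_nonneg_right (passProb_le_one (T := T) (w := w) i) (add_nonneg h3 h2)
    have h5 : luck p (w.length + 2) (.scan i q : Control m Q) (w.length + 1) =
      luck p (w.length + 2) (.back i : Control m Q) w.length := rfl
    rw [h5]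
    linarith
  · have hlt : i < Fin.last m := Fin.lt_last_iff_ne_last.2 hi
    have hv : ((i + 1 : Fin (m + 1)) : ℕ) = i + 1 := Fin.val_add_one_of_lt hlt
    have hi' : (i : ℕ) < m := hlt
    obtain ⟨d, hd⟩ : ∃ d, m - (i : ℕ) = d + 1 := ⟨m - i - 1, by omega⟩
    have hd' : m - ((i : ℕ) + 1) = d := by omega
    simp only [rank, hv, hd, hd', Nat.succ_mul]
    omega
  · simp only [luck, mul_zero, add_zero]
    exact (mul_pow_sub _ _ (by omega)).symm
  · simp [luck]
  · simp only [luck, sub_zero, mul_one, mul_sub, hδ]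
    rw [hs₀]
    simp [rank]

theorem machine_expectedTime_le (hp : 0 < (p : ℝ)) :
    (T.machine p).expectedTime w ≤ ENNReal.ofReal
      (rank (w.length + 2) (.scan 0 T.base : Control m Q) 0 / (p : ℝ) ^ (w.length + 2)) := by
  have h : ∀ s d : ℝ, 0 < d → s + s / d * (1 - d) ≤ s / d := by
    intro s d hd
    have : s / d * d = s := by field_simp
    linarith
  exact (potential_time hp).expectedTime_le.trans
    (ENNReal.ofReal_le_ofReal (h _ _ (by positivity)))

/-- If the `i₀`-th test fails with probability at least `r`, the machine rejects in a round with
probability at least `r`, and accepts with probability at most `δ = p ^ (n + 2)`. The potential is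
`a = δ / r` until that test is made and `a + δ` from then on until the coins are
tossed; it satisfies `(1 - r) * (a + δ) ≤ a`. -/
theorem potential_accept {r : ℝ} (hr : 0 < r) {i₀ : Fin (m + 1)}
    (h : T.passProb w i₀ ≤ 1 - r) :
    T.Potential p w 0 fun c j => match c with
      | .scan i _ => (p : ℝ) ^ (w.length + 2) / r + if i ≤ i₀ then 0 else (p : ℝ) ^ (w.length + 2)
      | .back i => (p : ℝ) ^ (w.length + 2) / r + if i < i₀ then 0 else (p : ℝ) ^ (w.length + 2)
      | .flip => (p : ℝ) ^ (w.length + 2) / r + (p : ℝ) ^ (w.length + 2 - j)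
      | .look => (p : ℝ) ^ (w.length + 2) / r + (p : ℝ) ^ (w.length + 2 - j)
      | .fail => (p : ℝ) ^ (w.length + 2) / r
      | .acc => 1
      | .rej => 0 := by
  have hp0 := p.2.1
  have hp1 := p.2.2
  have hδ : 0 ≤ (p : ℝ) ^ (w.length + 2) := by positivity
  have ha : 0 ≤ (p : ℝ) ^ (w.length + 2) / r := by positivity
  have har : (p : ℝ) ^ (w.length + 2) / r * r = (p : ℝ) ^ (w.length + 2) := by field_simp
  have hpow : ∀ j, 0 ≤ (p : ℝ) ^ (w.length + 2 - j) := fun j => by positivity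
  have hmul := mul_pow_sub (p := p) (w.length + 2)
  generalize (p : ℝ) ^ (w.length + 2) / r = a at *
  refine
    { nonneg := fun c j => ?_
      rej := fun j => rfl
      scan := fun i q q' j hj => by simp
      test := fun i q => ?_
      back := fun i j hj => by simp
      next := fun i hi => ?_
      last := ?_
      flip := fun j hj => by simp
      look := fun j hj => ?_
      accept := ?_
      fail := fun j hj => by simp
      restart := ?_ }
  · have := hpow j
    cases c <;> dsimp only <;> (try split_ifs) <;> positivity
  · have h1 := passProb_le_one (T := T) (w := w) i
    dsimp only
    rcases lt_trichotomy i i₀ with hi | hi | hi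
    · rw [if_pos hi, if_pos hi.le]; nlinarith
    · subst hi
      rw [if_neg (lt_irrefl _), if_pos le_rfl]
      have := mul_le_mul_of_nonneg_right h (add_nonneg ha hδ)
      nlinarith
    · rw [if_neg hi.not_gt, if_neg hi.not_ge]
      have := mul_le_mul_of_nonneg_right h1 (add_nonneg ha hδ)
      linarith
  · have hlt : i < Fin.last m := Fin.lt_last_iff_ne_last.2 hi
    have : i + 1 ≤ i₀ ↔ i < i₀ := by
      rw [Fin.le_def, Fin.val_add_one_of_lt hlt, Fin.lt_def]; omega
    simp [this]
  · simp [(Fin.le_last i₀).not_gt]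
  · have := hmul j (by omega)
    dsimp only
    nlinarith
  · have : w.length + 2 - (w.length + 1) = 1 := by omega
    dsimp only
    rw [this, pow_one]
    nlinarith
  · simp

theorem machine_acceptProb_le {r : ℝ} (hr : 0 < r) {i₀ : Fin (m + 1)}
    (h : T.passProb w i₀ ≤ 1 - r) :
    (T.machine p).acceptProb w ≤ ENNReal.ofReal ((p : ℝ) ^ (w.length + 2) / r) := by
  simpa using (potential_accept (p := p) hr h).acceptProb_le fun _ => le_rfl

/-! ### From test systems to the complexity class -/

theorem gaussDenominator_gateAfter {e : ℕ}
    (hT : ∀ i q a, GaussDenominator e (T.gate i q a)) (i : Fin (m + 1)) (w : List α) :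
    GaussDenominator (e * w.length) (T.gateAfter i w) := by
  induction w using List.reverseRecOn with
  | nil => exact GaussDenominator.one
  | append_singleton w a ih =>
    rw [gateAfter_append, List.length_append, List.length_singleton, mul_add, mul_one, add_comm]
    exact (hT _ _ _).mul ih

theorem passProb_le {e : ℕ} (hT : ∀ i q a, GaussDenominator e (T.gate i q a))
    {i : Fin (m + 1)} (h : T.passProb w i ≠ 1) :
    T.passProb w i ≤ 1 - ((25 : ℝ) ^ (e * w.length))⁻¹ := by
  rw [passProb] at h ⊢
  split_ifs at h ⊢ with hb
  · have := (gaussDenominator_gateAfter hT i w).le_norm_sq (i := 1) (j := 0)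
      fun h0 => h (by rw [h0]; simp)
    linarith
  · rw [sub_nonneg]
    exact inv_le_one_of_one_le₀ (one_le_pow₀ (by norm_num))

/-- With denominators `5 ^ e` a test that can fail at all fails with probability at least
`25 ^ (-e n)`. A coin that comes out right with probability at most `25 ^ (-e)` and `ε` makes
acceptance in a round rarer than that by the factor `ε`. -/
theorem exists_mem_coR2QCFA {Q : Type} [Finite Q] [Finite α] (T : TestSystem m Q α) {e : ℕ}
    (hT : ∀ i q a, GaussDenominator e (T.gate i q a)) {L : Language α}
    (hL : ∀ w, w ∈ L ↔ ∀ i, T.passProb w i = 1) {ε : ℝ} (hε : 0 < ε) :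
    ∃ D : ℝ, 1 ≤ D ∧ L ∈ coR2QCFA (fun n => D ^ n) ε 2 {z : ℂ | IsAlgebraic ℚ z} := by
  obtain ⟨k, hk⟩ := exists_nat_ge (max ((25 : ℝ) ^ e) ε⁻¹)
  have hk25 : (25 : ℝ) ^ e ≤ k := (le_max_left _ _).trans hk
  have hkε : ε⁻¹ ≤ k := (le_max_right _ _).trans hk
  have hk1 : (1 : ℝ) ≤ k := (one_le_pow₀ (by norm_num)).trans hk25
  have hk0 : (0 : ℝ) < k := by linarith
  let p : unitInterval := ⟨(k : ℝ)⁻¹, by positivity, inv_le_one_of_one_le₀ hk1⟩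
  have hp : (p : ℝ) = (k : ℝ)⁻¹ := rfl
  have hp0 : 0 < (p : ℝ) := by rw [hp]; positivity
  have htime : ∀ w, (T.machine p).expectedTime w ≠ ∞ := fun w =>
    ((machine_expectedTime_le hp0).trans_lt ENNReal.ofReal_lt_top).ne
  refine ⟨2 * k, by linarith, Control m Q, inferInstance, T.machine p, ?_, htime,
    ⟨(12 + 5 * m) * k ^ 2, 0, fun w _ => ?_⟩, fun w => ⟨?_, fun hw => ?_, fun hw => ?_⟩⟩
  · refine hasAmplitudesIn_machine p ?_ fun i q a j l => (hT i q a).isAlgebraic j l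
    rw [hp, Complex.ofReal_inv, Complex.ofReal_natCast]
    exact (isAlgebraic_natCast k).inv
  · refine (machine_expectedTime_le hp0).trans (ENNReal.ofReal_le_ofReal ?_)
    have h1 : rank (w.length + 2) (.scan 0 T.base : Control m Q) 0 ≤
        (12 + 5 * m) * 2 ^ w.length := by
      have h2 : w.length + 1 ≤ 2 ^ w.length := Nat.lt_two_pow_self
      simp only [rank, Fin.val_zero]
      have h3 := Nat.mul_le_mul_left m h2
      have h4 : 1 ≤ 2 ^ w.length := Nat.one_le_two_pow
      have h5 := Nat.mul_le_mul_left m h4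
      have h6 : m * (2 * (w.length + 2) + 1) = 2 * (m * (w.length + 1)) + 3 * (m * 1) := by ring
      have h7 : (12 + 5 * m) * 2 ^ w.length = 12 * 2 ^ w.length + 5 * (m * 2 ^ w.length) := by ring
      rw [Nat.sub_zero, h6, h7]
      omega
    have h1' : (rank (w.length + 2) (.scan 0 T.base : Control m Q) 0 : ℝ) ≤
        (12 + 5 * m) * 2 ^ w.length := by exact_mod_cast h1
    rw [hp, inv_pow, div_inv_eq_mul]
    calc _ ≤ ((12 + 5 * m) * 2 ^ w.length) * (k : ℝ) ^ (w.length + 2) := by gcongr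
      _ = (12 + 5 * m) * k ^ 2 * (2 * k) ^ w.length := by rw [mul_pow, pow_add]; ring
  · exact Machine.acceptProb_add_rejectProb (htime w)
  · have h := Machine.acceptProb_add_rejectProb (htime w)
    rwa [machine_rejectProb_eq_zero ((hL w).1 hw), add_zero] at h
  · rw [hL, not_forall] at hw
    obtain ⟨i, hi⟩ := hw
    have hacc : (T.machine p).acceptProb w ≤ ENNReal.ofReal ε := by
      refine (machine_acceptProb_le (by positivity) (passProb_le hT hi)).trans
        (ENNReal.ofReal_le_ofReal ?_)
      rw [div_inv_eq_mul, hp, pow_mul, pow_add, mul_right_comm, ← mul_pow]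
      have h1 : (k : ℝ)⁻¹ * 25 ^ e ≤ 1 := by
        rw [inv_mul_le_iff₀ hk0, mul_one]; exact hk25
      have h2 : (k : ℝ)⁻¹ ≤ ε := inv_le_of_inv_le₀ hε hkε
      have h3 : (k : ℝ)⁻¹ ≤ 1 := inv_le_one_of_one_le₀ hk1
      calc ((k : ℝ)⁻¹ * 25 ^ e) ^ w.length * (k : ℝ)⁻¹ ^ 2 ≤ 1 * (1 * ε) := by
            rw [sq]
            gcongr
            exact pow_le_one₀ (by positivity) h1
        _ = ε := by ring
    have h := Machine.acceptProb_add_rejectProb (htime w)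
    rw [ENNReal.ofReal_sub _ hε.le, ENNReal.ofReal_one, ← h]
    refine tsub_le_iff_left.2 ?_
    gcongr

end TestSystem

/-! ### Finite-index subgroups -/

section cosets

variable {P : Type*} [Group P] {H : Subgroup P} {N m : ℕ} {α : Type*}

/-- An element of the coset with number `q`. -/
noncomputable def cosetRep (e : P ⧸ H ≃ Fin N) (q : Fin N) : P := (e.symm q).out

theorem mk_cosetRep (e : P ⧸ H ≃ Fin N) (q : Fin N) : ((cosetRep e q : P) : P ⧸ H) = e.symm q :=
  Quotient.out_eq' _

/-- The Schreier element of a transition from the coset `q` under left multiplication by `g`. -/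
noncomputable def schreier (e : P ⧸ H ≃ Fin N) (q : Fin N) (g : P) : H :=
  ⟨(cosetRep e (e (g • e.symm q)))⁻¹ * (g * cosetRep e q), by
    rw [← QuotientGroup.eq, mk_cosetRep, Equiv.symm_apply_apply, ← mk_cosetRep e q]
    rfl⟩

/-- The automaton that follows the left cosets of `H` under left multiplication by the inverses of
the letters. The gates are the images of the Schreier elements under given representations
of `H`. -/
noncomputable def cosetSystem (e : P ⧸ H ≃ Fin N) (val : α → P)
    (rep : Fin (m + 1) → H →* Matrix.unitaryGroup (Fin 2) ℂ) : TestSystem m (Fin N) α where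
  base := e (1 : P)
  next q a := e ((val a)⁻¹ • e.symm q)
  gate i q a := rep i (schreier e q (val a)⁻¹)

variable (e : P ⧸ H ≃ Fin N) (val : α → P)
  (rep : Fin (m + 1) → H →* Matrix.unitaryGroup (Fin 2) ℂ)

theorem stateAfter_cosetSystem (w : List α) :
    (cosetSystem e val rep).stateAfter w = e (((w.map val).prod⁻¹ : P) : P ⧸ H) := by
  induction w using List.reverseRecOn with
  | nil => simp [TestSystem.stateAfter, cosetSystem]
  | append_singleton w a ih =>
    rw [TestSystem.stateAfter_append, ih]
    simp [cosetSystem]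

/-- The gates along `w` multiply to the image of an element of `H` that is conjugate to the inverse
of the value of `w` if the automaton returns to its initial state. -/
theorem gateAfter_cosetSystem (i : Fin (m + 1)) (w : List α) :
    ∃ x : H, (x : P) = (cosetRep e ((cosetSystem e val rep).stateAfter w))⁻¹ *
        ((w.map val).prod⁻¹ * cosetRep e (cosetSystem e val rep).base) ∧
      (cosetSystem e val rep).gateAfter i w = rep i x := by
  induction w using List.reverseRecOn with
  | nil => exact ⟨1, by simp [TestSystem.stateAfter], by
      simp [TestSystem.gateAfter, TestSystem.gateFrom]⟩
  | append_singleton w a ih =>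
    obtain ⟨x, hx, e'⟩ := ih
    refine ⟨schreier e ((cosetSystem e val rep).stateAfter w) (val a)⁻¹ * x, ?_, ?_⟩
    · rw [TestSystem.stateAfter_append, Subgroup.coe_mul, hx]
      simp [schreier, cosetSystem, mul_assoc]
    · rw [TestSystem.gateAfter_append, e', map_mul]
      rfl

/-- If the representations detect the nontrivial elements of `H` by their lower left entries, the
tests together decide whether the value of a word is trivial. -/
theorem forall_passProb_cosetSystem
    (hrep : ∀ x : H, x ≠ 1 → ∃ i, (rep i x : Matrix (Fin 2) (Fin 2) ℂ) 1 0 ≠ 0) (w : List α) :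
    (∀ i, (cosetSystem e val rep).passProb w i = 1) ↔ (w.map val).prod = 1 := by
  constructor
  · intro h
    by_contra hne
    have hb : (cosetSystem e val rep).stateAfter w = (cosetSystem e val rep).base := by
      by_contra hb
      have := h 0
      rw [TestSystem.passProb, if_neg hb] at this
      exact zero_ne_one this
    have hex : ∀ i, ∃ x : H, x ≠ 1 ∧
        (x : P) = (cosetRep e ((cosetSystem e val rep).stateAfter w))⁻¹ *
        ((w.map val).prod⁻¹ * cosetRep e (cosetSystem e val rep).base) ∧
        (cosetSystem e val rep).gateAfter i w = rep i x := by
      intro i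
      obtain ⟨x, hx, e'⟩ := gateAfter_cosetSystem e val rep i w
      refine ⟨x, ?_, hx, e'⟩
      rintro rfl
      rw [hb, OneMemClass.coe_one, eq_comm, inv_mul_eq_one, right_eq_mul, inv_eq_one] at hx
      exact hne hx
    obtain ⟨x, hx1, hx, -⟩ := hex 0
    obtain ⟨i, hi⟩ := hrep x hx1
    obtain ⟨y, -, hy, e'⟩ := hex i
    have hxy : x = y := Subtype.ext (hx.trans hy.symm)
    have := h i
    rw [TestSystem.passProb, if_pos hb, e', ← hxy] at this
    have h0 : 0 < ‖(rep i x : Matrix (Fin 2) (Fin 2) ℂ) 1 0‖ := norm_pos_iff.2 hi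
    nlinarith
  · intro h i
    have hb : (cosetSystem e val rep).stateAfter w = (cosetSystem e val rep).base := by
      rw [stateAfter_cosetSystem, h, inv_one]; rfl
    obtain ⟨x, hx, e'⟩ := gateAfter_cosetSystem e val rep i w
    have hx1 : x = 1 := Subtype.ext (by rw [hx, hb, h]; simp)
    rw [TestSystem.passProb, if_pos hb, e', hx1, map_one, Matrix.UnitaryGroup.one_val]
    simp

end cosets

theorem _root_.IsVirtuallySubgroupProdFree.of_mulEquiv {G P : Type*} [Group G] [Group P]
    (h : IsVirtuallySubgroupProdFree G) (e : G ≃* P) : IsVirtuallySubgroupProdFree P := by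
  obtain ⟨H, hH, m, k, f, hf⟩ := h
  refine ⟨H.map e.toMonoidHom, ?_, m, k, f.comp (e.subgroupMap H).symm.toMonoidHom,
    hf.comp (e.subgroupMap H).symm.injective⟩
  exact ⟨by
    have := Subgroup.index_map_equiv H e
    exact this ▸ hH.index_ne_zero⟩

end TwoQCFA

open TwoQCFA in
theorem theorem2 {G : Type*} [Group G] [Group.FG G] (hG : IsVirtuallySubgroupProdFree G)
    {S : Type*} [Finite S] (R : Set (FreeGroup S)) (hR : Nonempty (G ≃* PresentedGroup R))
    (ε : ℝ) (hε : 0 < ε) :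
    ∃ D : ℝ, 1 ≤ D ∧
      wordProblem R ∈
        TwoQCFA.coR2QCFA (fun n => D ^ n) ε 2 {z : ℂ | IsAlgebraic ℚ z} := by
  obtain ⟨φ⟩ := hR
  obtain ⟨H, hH, m, k, f, hf⟩ := hG.of_mulEquiv φ
  let e : PresentedGroup R ⧸ H ≃ Fin (Nat.card (PresentedGroup R ⧸ H)) := Finite.equivFin _
  -- One representation for every free factor, and a trivial one so that there is at least one.
  let rep : Fin (m + 1) → H →* Matrix.unitaryGroup (Fin 2) ℂ := fun i =>
    if h : (i : ℕ) < m then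
      freeRep.comp ((conjEmbedding (k ⟨i, h⟩)).comp ((Pi.evalMonoidHom _ ⟨i, h⟩).comp f))
    else 1
  have hrep : ∀ x : H, x ≠ 1 → ∃ i, (rep i x : Matrix (Fin 2) (Fin 2) ℂ) 1 0 ≠ 0 := by
    intro x hx
    have hfx : f x ≠ 1 := fun h => hx (hf (h.trans (map_one f).symm))
    obtain ⟨i, hi⟩ := Function.ne_iff.1 hfx
    refine ⟨i.castSucc, ?_⟩
    have : (i.castSucc : ℕ) < m := i.2
    simp only [rep, this, dif_pos]
    exact freeRep_conjEmbedding_ne_zero hi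
  have hden : ∀ i x, ∃ d, GaussDenominator d (rep i x) := by
    intro i x
    by_cases h : (i : ℕ) < m
    · simp only [rep, h, dif_pos]
      exact GaussDenominator.freeRep _
    · simp only [rep, h]
      exact ⟨0, GaussDenominator.one⟩
  have hgate : ∀ t : Fin (m + 1) × Fin (Nat.card (PresentedGroup R ⧸ H)) × (S ⊕ S),
      ∃ d, GaussDenominator d ((cosetSystem e (letterValue R) rep).gate t.1 t.2.1 t.2.2) :=
    fun t => hden _ _
  choose d hd using hgate
  -- There are finitely many gates, hence a common denominator.
  obtain ⟨b, hb⟩ := (Set.finite_range d).bddAbove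
  exact (cosetSystem e (letterValue R) rep).exists_mem_coR2QCFA
    (fun i q a => (hd (i, q, a)).mono (hb ⟨(i, q, a), rfl⟩))
    (fun w => (forall_passProb_cosetSystem e (letterValue R) rep hrep w).symm) hε
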